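/- Let $(M,g)$ be an oriented spacetime (a smooth four-dimensional manifold with a smooth metric of signature $(-,+,+,+)$), with Weyl tensor $W$ and Hodge dual $*W_{abcd}=\frac12\eta_{ab}{}^{ef}W_{efcd}$, and let $p\in M$. For $v\in T_pM$ put $E[v]_{ac}=W_{abcd}v^bv^d$ and $B[v]_{ac}=*W_{abcd}v^bv^d$. The (nonzero) vector $v$, or its direction, is called Weyl-aligned with rotation index $\sigma\in[0,\pi)$ if $\cos\sigma\,B[v]+\sin\sigma\,E[v]=0$, and Weyl-aligned if this holds for some $\sigma\in[0,\pi)$. A null vector $l\neq 0$ defines a multiple Debever direction (a principal null direction of multiplicity at least two) if $W_{abc[d}l_{e]}l^bl^c=0$. The self-dual Weyl tensor $\mathcal W=\frac12(W-\mathrm i\,{*W})$ acts on the three-dimensional complex space of bivectors (complex two-forms $\mathcal F$ with $*\mathcal F=\mathrm i\mathcal F$) by $\mathcal F_{ab}\mapsto\frac12\mathcal W_{ab}{}^{cd}\mathcal F_{cd}$; the metric is algebraically special at $p$ if this map does not have three different eigenvalues, that is, if it is not of Petrov type I (type O, $W=0$, is included). A direction is a Weyl principal direction if it is spanned by a vector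 of a Weyl canonical frame, i.e. of an orthonormal frame $e_0,e_1,e_2,e_3$ of $T_pM$ ($e_0$ timelike) such that, with $U_i=e_0\wedge e_i$, the bivectors $\frac1{\sqrt2}(U_i-\mathrm i\,{*U_i})$, $i=1,2,3$, are eigenvectors of this map. Then, at every point $p$: 1. If a timelike or null direction is Weyl-aligned with rotation index $\sigma$, then some spacelike direction is Weyl-aligned with the same rotation index $\sigma$. 2. A null direction is Weyl-aligned if and only if it is a multiple Debever direction. 3. There is a Weyl-aligned null direction at $p$ if and only if the metric is algebraically special at $p$. 4. Every timelike Weyl-aligned direction is a Weyl principal direction. -/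

import Mathlib

open scoped Manifold ContDiff

noncomputable section

namespace WeylAlign

/-- The model space of coordinates of a four-dimensional manifold. -/
abbrev R4 : Type := EuclideanSpace ℝ (Fin 4)

/-- The standard basis vectors of the coordinate space. -/
def stdVec (i : Fin 4) : R4 := EuclideanSpace.single i (1 : ℝ)

/-- The matrix `diag (-1, 1, 1, 1)`. -/
def minkowski : Matrix (Fin 4) (Fin 4) ℝ := Matrix.diagonal ![-1, 1, 1, 1]

/-! ### Spacetimes -/

section Spacetimes

variable {M : Type*} [TopologicalSpace M] [ChartedSpace R4 M]

/-- The `i`-th coordinate vector `∂_i` of a chart `φ`, at the point with coordinates `y`. -/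
def coordVec (φ : OpenPartialHomeomorph M R4) (y : R4) (i : Fin 4) :
    TangentSpace (𝓡 4) (φ.symm y) :=
  mfderiv (𝓡 4) (𝓡 4) φ.symm y ((NormedSpace.fromTangentSpace (𝕜 := ℝ) y).symm (stdVec i))

/-- Components `g_{ij}(y) = g(∂_i, ∂_j)` of a field `g` of bilinear forms in the coordinates of a
chart `φ`. -/
def metricComp
    (g : ∀ x : M, TangentSpace (𝓡 4) x →L[ℝ] TangentSpace (𝓡 4) x →L[ℝ] ℝ)
    (φ : OpenPartialHomeomorph M R4) (y : R4) : Matrix (Fin 4) (Fin 4) ℝ :=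
  Matrix.of fun i j =>
    g (φ.symm y) (coordVec φ y i) (coordVec φ y j)

end Spacetimes

/-- An oriented spacetime structure on a smooth four-dimensional manifold `M`: a smooth metric
tensor of signature `(-, +, +, +)`.  The orientation is the one given by the atlas of `M`, whose
changes of coordinates are required to have positive Jacobian. -/
structure Spacetime (M : Type*) [TopologicalSpace M] [ChartedSpace R4 M]
    [IsManifold (𝓡 4) ∞ M] where
  /-- The metric tensor. -/
  g : ∀ x : M, TangentSpace (𝓡 4) x →L[ℝ] TangentSpace (𝓡 4) x →L[ℝ] ℝ
  symm : ∀ (x : M) (v w : TangentSpace (𝓡 4) x), g x v w = g x w v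
  lorentzian : ∀ x : M, ∃ e : Module.Basis (Fin 4) ℝ (TangentSpace (𝓡 4) x),
    ∀ i j, g x (e i) (e j) = minkowski i j
  smooth : ∀ φ ∈ atlas R4 M, ∀ i j : Fin 4,
    ContDiffOn ℝ ∞ (fun y => metricComp g φ y i j) φ.target
  oriented : ∀ φ ∈ atlas R4 M, ∀ ψ ∈ atlas R4 M, ∀ y ∈ (φ.symm.trans ψ).source,
    0 < (fderiv ℝ (φ.symm.trans ψ) y).det

/-! ### Curvature of a metric given by its components `G : R4 → Matrix` in a coordinate domain -/

section Curvature

/-- Partial derivative with respect to the `k`-th coordinate. -/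
def pd (k : Fin 4) (f : R4 → ℝ) (y : R4) : ℝ := fderiv ℝ f y (stdVec k)

variable (G : R4 → Matrix (Fin 4) (Fin 4) ℝ) (y : R4)

/-- Christoffel symbols `Γ^a_{bc}` of the Levi-Civita connection. -/
def christoffel (a b c : Fin 4) (y : R4) : ℝ :=
  (1 / 2) * ∑ d, (G y)⁻¹ a d *
    (pd b (fun z => G z d c) y + pd c (fun z => G z d b) y - pd d (fun z => G z b c) y)

/-- The Riemann tensor `R^a_{bcd}`. -/
def riemannUp (a b c d : Fin 4) : ℝ :=
  pd c (christoffel G a d b) y - pd d (christoffel G a c b) y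
    + ∑ e, christoffel G a c e y * christoffel G e d b y
    - ∑ e, christoffel G a d e y * christoffel G e c b y

/-- The Riemann tensor `R_{abcd}`. -/
def riemann (a b c d : Fin 4) : ℝ := ∑ e, G y a e * riemannUp G y e b c d

/-- The Ricci tensor `R_{bd} = R^a_{bad}`. -/
def ricci (b d : Fin 4) : ℝ := ∑ a, riemannUp G y a b a d

/-- The scalar curvature. -/
def scalarCurv : ℝ := ∑ a, ∑ b, (G y)⁻¹ a b * ricci G y a b

/-- The Weyl tensor `W_{abcd}` in dimension four. -/
def weylTensor (a b c d : Fin 4) : ℝ :=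
  riemann G y a b c d
    - (1 / 2) * (G y a c * ricci G y b d - G y a d * ricci G y b c
        + G y b d * ricci G y a c - G y b c * ricci G y a d)
    + (scalarCurv G y / 6) * (G y a c * G y b d - G y a d * G y b c)

end Curvature

/-! ### Algebra of two-forms and Weyl tensors at a point, in components.
Here `g` is the matrix of the metric, `W` a tensor with four lower indices. -/

section PointAlgebra

/-- The Levi-Civita symbol `ε_{abcd}`, with `ε_{0123} = 1`. -/
def leviCivita (a b c d : Fin 4) : ℝ :=
  Matrix.det (Matrix.of fun i j : Fin 4 => if ![a, b, c, d] i = j then (1 : ℝ) else 0)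

variable (g : Matrix (Fin 4) (Fin 4) ℝ)

/-- The metric volume element `η_{abcd}` in positively oriented coordinates. -/
def volForm (a b c d : Fin 4) : ℝ := √|g.det| * leviCivita a b c d

/-- The volume element `η_{ab}{}^{cd}`, with the last two indices raised. -/
def volFormUp (a b c d : Fin 4) : ℝ := ∑ e, ∑ f, volForm g a b e f * g⁻¹ e c * g⁻¹ f d

/-- The Hodge dual `*W_{abcd} = (1/2) η_{ab}{}^{ef} W_{efcd}`. -/
def dualTensor (W : Fin 4 → Fin 4 → Fin 4 → Fin 4 → ℝ) (a b c d : Fin 4) : ℝ :=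
  (1 / 2) * ∑ e, ∑ f, volFormUp g a b e f * W e f c d

/-- `W(v;v)_{ac} = W_{abcd} v^b v^d`. -/
def contractVec (W : Fin 4 → Fin 4 → Fin 4 → Fin 4 → ℝ) (v : Fin 4 → ℝ) :
    Matrix (Fin 4) (Fin 4) ℝ :=
  Matrix.of fun a c => ∑ b, ∑ d, W a b c d * v b * v d

/-- The relative electric field `E[v] = W(v;v)`. -/
def electric (W : Fin 4 → Fin 4 → Fin 4 → Fin 4 → ℝ) (v : Fin 4 → ℝ) :
    Matrix (Fin 4) (Fin 4) ℝ := contractVec W v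

/-- The relative magnetic field `B[v] = *W(v;v)`. -/
def magnetic (W : Fin 4 → Fin 4 → Fin 4 → Fin 4 → ℝ) (v : Fin 4 → ℝ) :
    Matrix (Fin 4) (Fin 4) ℝ := contractVec (dualTensor g W) v

/-- The Hodge dual of a complex two-form, `*F_{ab} = (1/2) η_{ab}{}^{cd} F_{cd}`. -/
def dualForm (F : Matrix (Fin 4) (Fin 4) ℂ) : Matrix (Fin 4) (Fin 4) ℂ :=
  Matrix.of fun a b => (1 / 2) * ∑ c, ∑ d, (volFormUp g a b c d : ℂ) * F c d

/-- `F` is a bivector: a complex two-form which is self-dual, `*F = i F`. -/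
def IsBivector (F : Matrix (Fin 4) (Fin 4) ℂ) : Prop :=
  (∀ a b, F a b = - F b a) ∧ dualForm g F = Complex.I • F

/-- The self-dual tensor `(1/2) (W - i *W)`. -/
def selfDualTensor (W : Fin 4 → Fin 4 → Fin 4 → Fin 4 → ℝ) (a b c d : Fin 4) : ℂ :=
  (1 / 2) * ((W a b c d : ℂ) - Complex.I * (dualTensor g W a b c d : ℂ))

/-- The linear map `F_{ab} ↦ (1/2) 𝒲_{ab}{}^{cd} F_{cd}` on two-forms defined by the self-dual
tensor `𝒲` of `W`. -/
def weylMap (W : Fin 4 → Fin 4 → Fin 4 → Fin 4 → ℝ) (F : Matrix (Fin 4) (Fin 4) ℂ) :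
    Matrix (Fin 4) (Fin 4) ℂ :=
  Matrix.of fun a b => (1 / 2) * ∑ c, ∑ d, ∑ e, ∑ f,
    selfDualTensor g W a b e f * (g⁻¹ e c : ℂ) * (g⁻¹ f d : ℂ) * F c d

/-- `F` is an eigenbivector of the self-dual tensor of `W`, with eigenvalue `ρ`. -/
def IsEigenbivector (W : Fin 4 → Fin 4 → Fin 4 → Fin 4 → ℝ) (ρ : ℂ)
    (F : Matrix (Fin 4) (Fin 4) ℂ) : Prop :=
  IsBivector g F ∧ F ≠ 0 ∧ weylMap g W F = ρ • F

/-- The covector `v_a = g_{ab} v^b`. -/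
def lower (v : Fin 4 → ℝ) (a : Fin 4) : ℝ := ∑ b, g a b * v b

/-- The complex two-form `(1/√2) (U - i *U)` of the real two-form `U = v ∧ w`. -/
def bivectorOf (v w : Fin 4 → ℝ) : Matrix (Fin 4) (Fin 4) ℂ :=
  let U : Matrix (Fin 4) (Fin 4) ℂ := Matrix.of fun a b =>
    ((lower g v a * lower g w b - lower g v b * lower g w a : ℝ) : ℂ)
  ((1 / √2 : ℝ) : ℂ) • (U - Complex.I • dualForm g U)

end PointAlgebra

/-! ### The Weyl tensor of a spacetime -/

namespace Spacetime

variable {M : Type*} [TopologicalSpace M] [ChartedSpace R4 M] [IsManifold (𝓡 4) ∞ M]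
  (S : Spacetime M) (p : M)

/-- The components of a tangent vector at `p` in the coordinates of the chart at `p`. -/
def comp {p : M} (v : TangentSpace (𝓡 4) p) (i : Fin 4) : ℝ :=
  NormedSpace.fromTangentSpace (𝕜 := ℝ) (chartAt R4 p p)
    (mfderiv (𝓡 4) (𝓡 4) (chartAt R4 p) p v) i

/-- The components of the metric at `p` in the coordinates of the chart at `p`. -/
def metricAt : Matrix (Fin 4) (Fin 4) ℝ :=
  metricComp S.g (chartAt R4 p) (chartAt R4 p p)

/-- The components of the Weyl tensor at `p` in the coordinates of the chart at `p`. -/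
def weylAt : Fin 4 → Fin 4 → Fin 4 → Fin 4 → ℝ :=
  weylTensor (metricComp S.g (chartAt R4 p)) (chartAt R4 p p)

variable {p}

def IsTimelike (v : TangentSpace (𝓡 4) p) : Prop := S.g p v v < 0

def IsSpacelike (v : TangentSpace (𝓡 4) p) : Prop := 0 < S.g p v v

def IsNull (v : TangentSpace (𝓡 4) p) : Prop := v ≠ 0 ∧ S.g p v v = 0

/-- The metric is Weyl-aligned at `p` for the direction of the nonzero vector `v`, with associated
rotation index `σ`. -/
def IsWeylAlignedWith (v : TangentSpace (𝓡 4) p) (σ : ℝ) : Prop :=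
  v ≠ 0 ∧ 0 ≤ σ ∧ σ < Real.pi ∧
    Real.cos σ • magnetic (S.metricAt p) (S.weylAt p) (comp v)
      + Real.sin σ • electric (S.weylAt p) (comp v) = 0

/-- `v` defines a Weyl-aligned direction. -/
def IsWeylAligned (v : TangentSpace (𝓡 4) p) : Prop := ∃ σ : ℝ, S.IsWeylAlignedWith v σ

/-- `l` defines a multiple Debever direction (a principal null direction of multiplicity at least
two): `l` is null and `W_{abc[d} l_{e]} l^b l^c = 0`. -/
def IsMultipleDebever (l : TangentSpace (𝓡 4) p) : Prop :=
  S.IsNull l ∧ ∀ a d e : Fin 4,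
    (∑ b, ∑ c, S.weylAt p a b c d * comp l b * comp l c) * lower (S.metricAt p) (comp l) e
      - (∑ b, ∑ c, S.weylAt p a b c e * comp l b * comp l c) * lower (S.metricAt p) (comp l) d = 0

/-- The Weyl tensor at `p` is of Petrov type I (algebraically general): the self-dual Weyl tensor
has three different eigenvalues on the space of bivectors. -/
def IsPetrovTypeI (p : M) : Prop :=
  ∃ ρ : Fin 3 → ℂ, Function.Injective ρ ∧
    ∀ i, ∃ F, IsEigenbivector (S.metricAt p) (S.weylAt p) (ρ i) F

/-- The metric is algebraically special at `p`: its Petrov type is II, III, D, N or O. -/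
def IsAlgebraicallySpecial (p : M) : Prop := ¬ S.IsPetrovTypeI p

/-- An orthonormal frame `e₀, e₁, e₂, e₃` (with `e₀` timelike) of the tangent space at `p`. -/
def IsOrthonormalFrame (e : Fin 4 → TangentSpace (𝓡 4) p) : Prop :=
  ∀ i j, S.g p (e i) (e j) = minkowski i j

/-- A Weyl canonical frame: an orthonormal frame such that the unitary bivectors of the
two-planes `e₀ ∧ eᵢ`, `i = 1, 2, 3`, are eigenbivectors of the self-dual Weyl tensor. -/
def IsWeylCanonicalFrame (e : Fin 4 → TangentSpace (𝓡 4) p) : Prop :=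
  S.IsOrthonormalFrame e ∧ ∀ i : Fin 3, ∃ ρ : ℂ,
    IsEigenbivector (S.metricAt p) (S.weylAt p) ρ
      (bivectorOf (S.metricAt p) (comp (e 0)) (comp (e i.succ)))

/-- `v` defines a Weyl principal direction: it has the direction of a vector of a Weyl canonical
frame.  For Petrov type I the canonical frame is unique up to signs and order, so that there are
exactly four principal directions; for type D the principal directions are those which are not
null in the two principal two-planes. -/
def IsWeylPrincipal (v : TangentSpace (𝓡 4) p) : Prop :=
  ∃ e : Fin 4 → TangentSpace (𝓡 4) p, S.IsWeylCanonicalFrame e ∧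
    ∃ (α : Fin 4) (c : ℝ), c ≠ 0 ∧ v = c • e α

end Spacetime

end WeylAlign

end

/-! Everything happens in one tangent space. Once `isWeylTensor_weylTensor` shows that the
coordinate Weyl tensor is trace-free and has the symmetries of a curvature tensor, it can be moved
to a positively oriented orthonormal frame (`IsFrame`, `pull`). There it is given by symmetric
trace-free real matrices E and B (`IsWeylTensor.exists_ofEB`). Bivectors become vectors of ℂ³, and
the self-dual map becomes multiplication by -Q, where Q = E - iB (`weylMap_ofEB`).

Alignment with index σ says that the rotated tensor cos σ *W + sin σ W has zero contraction with v
twice. This is again a Weyl tensor, with Q replaced by (sin σ + i cos σ) Q (`alignTensor_ofEB`), so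
σ can be absorbed.

Null case: for l = e₀ + e₃, the contraction of the rotated tensor vanishes when (1, i, 0) is an
eigenvector of Q and one more real equation holds. The eigenvector condition is the multiple Debever
condition and does not depend on σ; some σ always solves the extra equation
(`exists_rotationIndex`). Up to a rotation and a scalar, every isotropic vector of ℂ³ is (1, i, 0),
so an aligned null direction exists exactly when Q has an isotropic eigenvector. For complex
symmetric Q this means failing to have three distinct eigenvalues
(`exists_isotropic_eigenvector_iff`).

Timelike case: if e₀ is aligned, the rotated electric part vanishes, so E and B are multiples of one
real symmetric matrix. A rotation diagonalises both (`exists_diagonal_frame`), and that frame is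
canonical. The rotated tensor is then purely magnetic and diagonal, hence also annihilates e₁.

A spacelike aligned vector for null l is sought among the unit vectors orthogonal to l. Only two
scalar equations remain there, and they can be solved (`exists_spacelike_of_null`). -/

open scoped Manifold ContDiff

noncomputable section

namespace WeylAlign

/-! ### Components of vectors and of the metric in a chart. -/

section Geometry

variable {M : Type*} [TopologicalSpace M] [ChartedSpace R4 M]

/-- Components of a tangent vector at `x` in the chart `φ`. -/
def chartComp (φ : OpenPartialHomeomorph M R4) (x : M) (v : TangentSpace (𝓡 4) x) : R4 :=
  mfderiv (𝓡 4) (𝓡 4) φ x v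

theorem R4_eq_sum (v : R4) : v = ∑ i, v i • stdVec i := by
  ext j
  simp [stdVec, Finset.sum_apply, Pi.single_apply]

/-- The differentials of `φ` and `φ.symm` are mutually inverse, so the injective differential of `φ`
carries this to the expansion of a vector of `R4` in the standard basis. -/
theorem eq_sum_coordVec {φ : OpenPartialHomeomorph M R4} (hφ : φ.MDifferentiable (𝓡 4) (𝓡 4))
    {y : R4} (hy : y ∈ φ.target) (v : TangentSpace (𝓡 4) (φ.symm y)) :
    v = ∑ i, chartComp φ _ v i • coordVec φ y i := by
  have hs : φ.symm y ∈ φ.source := φ.map_target hy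
  apply hφ.mfderiv_injective hs
  rw [map_sum]
  have h : ∀ w : R4, (mfderiv (𝓡 4) (𝓡 4) φ (φ.symm y)
      (mfderiv (𝓡 4) (𝓡 4) φ.symm y w) : R4) = w := fun w =>
    DFunLike.congr_fun (hφ.comp_symm_deriv hy) w
  refine (R4_eq_sum (chartComp φ _ v)).trans (Finset.sum_congr rfl fun i _ => ?_)
  rw [map_smul]
  exact congrArg (fun u : R4 => chartComp φ _ v i • u) (h (stdVec i)).symm

theorem metric_eq_sum_metricComp
    (g : ∀ x : M, TangentSpace (𝓡 4) x →L[ℝ] TangentSpace (𝓡 4) x →L[ℝ] ℝ)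
    {φ : OpenPartialHomeomorph M R4} (hφ : φ.MDifferentiable (𝓡 4) (𝓡 4))
    {y : R4} (hy : y ∈ φ.target) {x : M} (hx : φ.symm y = x) (v w : TangentSpace (𝓡 4) x) :
    g x v w = ∑ i, ∑ j, chartComp φ x v i * metricComp g φ y i j * chartComp φ x w j := by
  subst hx
  conv_lhs => rw [eq_sum_coordVec hφ hy v, eq_sum_coordVec hφ hy w]
  simp only [map_sum, map_smul, sum_apply, smul_apply,
    smul_eq_mul, Finset.mul_sum, metricComp, Matrix.of_apply]
  rw [Finset.sum_comm]
  refine Finset.sum_congr rfl fun i _ => Finset.sum_congr rfl fun j _ => by ring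

end Geometry

/-! ### The tangent space at a point, identified with coordinate vectors. -/

namespace Spacetime

variable {M : Type*} [TopologicalSpace M] [ChartedSpace R4 M] [IsManifold (𝓡 4) ∞ M]
  (S : Spacetime M) (p : M)

theorem mdifferentiable_chartAt (p : M) : (chartAt R4 p).MDifferentiable (𝓡 4) (𝓡 4) :=
  haveI : IsManifold (𝓡 4) 1 M := IsManifold.of_le (n := ∞) (by norm_num)
  mdifferentiable_chart p

/-- Taking components is a linear equivalence. -/
def compEquiv : TangentSpace (𝓡 4) p ≃ₗ[ℝ] (Fin 4 → ℝ) :=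
  (LinearEquiv.ofBijective (mfderiv (𝓡 4) (𝓡 4) (chartAt R4 p) p).toLinearMap
    ((mdifferentiable_chartAt p).mfderiv_bijective (mem_chart_source R4 p))).trans
    ((NormedSpace.fromTangentSpace (𝕜 := ℝ) (chartAt R4 p p)).toLinearEquiv.trans
      (WithLp.linearEquiv 2 ℝ (Fin 4 → ℝ)))

variable {p}

theorem compEquiv_apply (v : TangentSpace (𝓡 4) p) : compEquiv p v = comp v := rfl

theorem comp_smul (c : ℝ) (v : TangentSpace (𝓡 4) p) : comp (c • v) = c • comp v := by
  simp only [← compEquiv_apply, map_smul]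

theorem comp_symm (x : Fin 4 → ℝ) : comp ((compEquiv p).symm x) = x := by
  rw [← compEquiv_apply, LinearEquiv.apply_symm_apply]

theorem comp_injective : Function.Injective (comp (M := M) (p := p)) := (compEquiv p).injective

theorem comp_ne_zero {v : TangentSpace (𝓡 4) p} : comp v ≠ 0 ↔ v ≠ 0 := by
  rw [← compEquiv_apply, ne_eq, LinearEquiv.map_eq_zero_iff]

theorem g_eq_metricAt (v w : TangentSpace (𝓡 4) p) :
    S.g p v w = comp v ⬝ᵥ (S.metricAt p).mulVec (comp w) := by
  rw [metric_eq_sum_metricComp S.g (mdifferentiable_chartAt p) (mem_chart_target R4 p)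
    ((chartAt R4 p).left_inv (mem_chart_source R4 p)) v w]
  simp only [dotProduct, Matrix.mulVec, Finset.mul_sum]
  exact Finset.sum_congr rfl fun i _ => Finset.sum_congr rfl fun j _ => mul_assoc _ _ _

theorem metricComp_symm (φ : OpenPartialHomeomorph M R4) (y : R4) (i j : Fin 4) :
    metricComp S.g φ y i j = metricComp S.g φ y j i := S.symm _ _ _

/-- At every point there is an orthonormal frame, here written as a matrix of components. -/
theorem exists_frame_matrix : ∃ P : Matrix (Fin 4) (Fin 4) ℝ,
    P.transpose * S.metricAt p * P = minkowski := by
  obtain ⟨e, he⟩ := S.lorentzian p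
  refine ⟨Matrix.of fun i j => comp (e j) i, Matrix.ext fun i j => ?_⟩
  rw [← he i j, S.g_eq_metricAt, Matrix.mul_assoc]
  simp [Matrix.mul_apply, dotProduct, Matrix.mulVec]

theorem metricComp_contDiffAt (i j : Fin 4) :
    ContDiffAt ℝ ∞ (fun y => metricComp S.g (chartAt R4 p) y i j) (chartAt R4 p p) :=
  (S.smooth _ (chart_mem_atlas R4 p) i j).contDiffAt
    ((chartAt R4 p).open_target.mem_nhds (mem_chart_target R4 p))

end Spacetime

end WeylAlign

/-! ### Symmetries of the Riemann and Weyl tensors in coordinates. -/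

namespace WeylAlign

/-- The algebraic symmetries of a Weyl tensor with respect to the metric `g`. -/
structure IsWeylTensor (g : Matrix (Fin 4) (Fin 4) ℝ)
    (W : Fin 4 → Fin 4 → Fin 4 → Fin 4 → ℝ) : Prop where
  antisymm_left : ∀ a b c d, W a b c d = -W b a c d
  antisymm_right : ∀ a b c d, W a b c d = -W a b d c
  pair_symm : ∀ a b c d, W a b c d = W c d a b
  bianchi : ∀ a b c d, W a b c d + W a c d b + W a d b c = 0
  trace : ∀ b d, ∑ a, ∑ c, g⁻¹ a c * W a b c d = 0

section Curvature

variable {G : R4 → Matrix (Fin 4) (Fin 4) ℝ} {y : R4}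

/-- Christoffel symbols of the first kind. -/
def christoffelLow (G : R4 → Matrix (Fin 4) (Fin 4) ℝ) (a b c : Fin 4) (y : R4) : ℝ :=
  (1 / 2) * (pd b (fun z => G z a c) y + pd c (fun z => G z a b) y - pd a (fun z => G z b c) y)

theorem christoffel_eq_sum (a b c : Fin 4) (y : R4) :
    christoffel G a b c y = ∑ d, (G y)⁻¹ a d * christoffelLow G d b c y := by
  simp only [christoffel, christoffelLow, Finset.mul_sum]
  exact Finset.sum_congr rfl fun d _ => by ring

theorem christoffelLow_comm (hG : ∀ z i j, G z i j = G z j i) (a b c : Fin 4) (y : R4) :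
    christoffelLow G a b c y = christoffelLow G a c b y := by
  simp only [christoffelLow, hG _ b c]
  ring

theorem christoffel_comm (hG : ∀ z i j, G z i j = G z j i) (a b c : Fin 4) :
    christoffel G a b c = christoffel G a c b := by
  funext y
  simp only [christoffel_eq_sum, christoffelLow_comm hG _ b c]

theorem sum_christoffel {y : R4} (h : (G y).det ≠ 0) (a b c : Fin 4) :
    ∑ e, G y a e * christoffel G e b c y = christoffelLow G a b c y := by
  have := congrFun (Matrix.mulVec_mulVec (fun d => christoffelLow G d b c y) (G y) (G y)⁻¹) a
  rw [Matrix.mul_nonsing_inv _ (isUnit_iff_ne_zero.2 h), Matrix.one_mulVec] at this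
  simp only [christoffel_eq_sum]
  simpa only [Matrix.mulVec, dotProduct] using this

/-- Metric compatibility of the Levi-Civita connection. -/
theorem pd_eq_low (hG : ∀ z i j, G z i j = G z j i) (a c e : Fin 4) (y : R4) :
    pd c (fun z => G z a e) y = christoffelLow G a c e y + christoffelLow G e c a y := by
  simp only [christoffelLow, hG _ e a, hG _ c a, hG _ c e]
  ring

theorem contDiffAt_pd {f : R4 → ℝ} (hf : ContDiffAt ℝ ∞ f y) (k : Fin 4) :
    ContDiffAt ℝ ∞ (pd k f) y :=
  (hf.fderiv_right (m := ∞) (by norm_num)).clm_apply contDiffAt_const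

theorem pd_comm {f : R4 → ℝ} (hf : ContDiffAt ℝ ∞ f y) (k l : Fin 4) :
    pd k (pd l f) y = pd l (pd k f) y := by
  have hd : DifferentiableAt ℝ (fderiv ℝ f) y :=
    (hf.fderiv_right (m := ∞) (by norm_num)).differentiableAt (by simp)
  have h : ∀ k l, pd k (pd l f) y = fderiv ℝ (fderiv ℝ f) y (stdVec k) (stdVec l) := by
    intro k l
    change fderiv ℝ (fun z => fderiv ℝ f z (stdVec l)) y (stdVec k) = _
    rw [fderiv_clm_apply hd (differentiableAt_const _)]
    simp
  rw [h, h]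
  exact (hf.isSymmSndFDerivAt (by simpa using WithTop.coe_le_coe.2 (le_top (a := (2 : ℕ∞))))).eq _ _

theorem contDiffAt_det (hs : ∀ i j, ContDiffAt ℝ ∞ (fun z => G z i j) y) :
    ContDiffAt ℝ ∞ (fun z => (G z).det) y := by
  simp only [Matrix.det_apply]
  refine ContDiffAt.sum fun σ _ => ContDiffAt.const_smul _ ?_
  exact contDiffAt_prod fun i _ => hs _ _

/-- Cramer's rule: an adjugate entry is the determinant of `G` with one row replaced by a constant
row. -/
theorem contDiffAt_inv (hs : ∀ i j, ContDiffAt ℝ ∞ (fun z => G z i j) y) (h : (G y).det ≠ 0)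
    (i j : Fin 4) : ContDiffAt ℝ ∞ (fun z => (G z)⁻¹ i j) y := by
  simp only [Matrix.inv_def, Ring.inverse_eq_inv', Matrix.smul_apply, smul_eq_mul,
    Matrix.adjugate_apply]
  refine ((contDiffAt_det hs).inv h).mul (contDiffAt_det fun k l => ?_)
  by_cases hk : k = j
  · subst hk
    simpa using contDiffAt_const
  · simpa [Matrix.updateRow_ne hk] using hs k l

theorem contDiffAt_christoffelLow (hs : ∀ i j, ContDiffAt ℝ ∞ (fun z => G z i j) y)
    (a b c : Fin 4) : ContDiffAt ℝ ∞ (christoffelLow G a b c) y :=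
  contDiffAt_const.mul (((contDiffAt_pd (hs a c) b).add (contDiffAt_pd (hs a b) c)).sub
    (contDiffAt_pd (hs b c) a))

theorem contDiffAt_christoffel (hs : ∀ i j, ContDiffAt ℝ ∞ (fun z => G z i j) y)
    (h : (G y).det ≠ 0) (a b c : Fin 4) : ContDiffAt ℝ ∞ (christoffel G a b c) y := by
  rw [funext (christoffel_eq_sum (G := G) a b c)]
  exact ContDiffAt.sum fun d _ => (contDiffAt_inv hs h a d).mul (contDiffAt_christoffelLow hs d b c)

theorem differentiableAt_of_smooth {f : R4 → ℝ} (hf : ContDiffAt ℝ ∞ f y) :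
    DifferentiableAt ℝ f y := hf.differentiableAt (by simp)

theorem sum_pd_christoffel (hs : ∀ i j, ContDiffAt ℝ ∞ (fun z => G z i j) y)
    (hG : ∀ z i j, G z i j = G z j i) (h : (G y).det ≠ 0) (a b c k : Fin 4) :
    ∑ e, G y a e * pd k (christoffel G e b c) y = pd k (christoffelLow G a b c) y
      - ∑ e, (christoffelLow G a k e y + christoffelLow G e k a y) * christoffel G e b c y := by
  -- Differentiating needs the lowering identity on a neighbourhood of `y`; invertibility is an open
  -- condition.
  have hev : (fun z => ∑ e, G z a e * christoffel G e b c z) =ᶠ[nhds y] christoffelLow G a b c :=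
    ((contDiffAt_det hs).continuousAt.eventually_ne h).mono fun z hz => sum_christoffel hz a b c
  have hd : ∀ e, DifferentiableAt ℝ (fun z => G z a e) y := fun e =>
    differentiableAt_of_smooth (hs a e)
  have hc : ∀ e, DifferentiableAt ℝ (christoffel G e b c) y := fun e =>
    differentiableAt_of_smooth (contDiffAt_christoffel hs h e b c)
  have key : pd k (christoffelLow G a b c) y
      = ∑ e, fderiv ℝ (fun z => G z a e * christoffel G e b c z) y (stdVec k) := by
    rw [pd, ← hev.fderiv_eq, fderiv_fun_sum fun e _ => (hd e).fun_mul (hc e), sum_apply]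
  rw [key, ← Finset.sum_sub_distrib]
  refine Finset.sum_congr rfl fun e _ => ?_
  rw [fderiv_fun_mul (hd e) (hc e), ← pd_eq_low hG]
  simp only [add_apply, smul_apply, smul_eq_mul, pd]
  ring

/-- The product rule for the lowered index cancels the terms with `christoffelLow G a c e`. In the
quadratic terms that remain, exchanging a and b can be compared directly. -/
theorem riemann_eq (hs : ∀ i j, ContDiffAt ℝ ∞ (fun z => G z i j) y)
    (hG : ∀ z i j, G z i j = G z j i) (h : (G y).det ≠ 0) (a b c d : Fin 4) :
    riemann G y a b c d = pd c (christoffelLow G a d b) y - pd d (christoffelLow G a c b) y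
      - ∑ e, christoffelLow G e c a y * christoffel G e d b y
      + ∑ e, christoffelLow G e d a y * christoffel G e c b y := by
  have hq : ∀ c d, ∑ e, G y a e * ∑ f, christoffel G e c f y * christoffel G f d b y
      = ∑ f, christoffelLow G a c f y * christoffel G f d b y := by
    intro c d
    simp only [Finset.mul_sum]
    rw [Finset.sum_comm]
    refine Finset.sum_congr rfl fun f _ => ?_
    rw [← sum_christoffel h, Finset.sum_mul]
    exact Finset.sum_congr rfl fun e _ => by ring
  simp only [riemann, riemannUp, mul_sub, mul_add, Finset.sum_sub_distrib, Finset.sum_add_distrib,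
    hq, sum_pd_christoffel hs hG h]
  simp only [add_mul, Finset.sum_add_distrib]
  ring

theorem pd_christoffelLow (hs : ∀ i j, ContDiffAt ℝ ∞ (fun z => G z i j) y) (a b c k : Fin 4) :
    pd k (christoffelLow G a b c) y = (1 / 2) * (pd k (pd b (fun z => G z a c)) y
      + pd k (pd c (fun z => G z a b)) y - pd k (pd a (fun z => G z b c)) y) := by
  have h : ∀ i j l, DifferentiableAt ℝ (pd l (fun z => G z i j)) y := fun i j l =>
    differentiableAt_of_smooth (contDiffAt_pd (hs i j) l)
  have : pd k (christoffelLow G a b c) y = fderiv ℝ (fun z => (1 / 2 : ℝ) *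
    (pd b (fun z => G z a c) z + pd c (fun z => G z a b) z - pd a (fun z => G z b c) z)) y
    (stdVec k) := rfl
  rw [this, fderiv_const_mul (((h _ _ _).fun_add (h _ _ _)).fun_sub (h _ _ _)),
    fderiv_fun_sub ((h _ _ _).fun_add (h _ _ _)) (h _ _ _), fderiv_fun_add (h _ _ _) (h _ _ _)]
  rfl

/-- Both sides are the inner product, with respect to `G`, of the vectors Γ_{ab} and Γ_{cd}. -/
theorem sum_low_christoffel_comm (hG : ∀ z i j, G z i j = G z j i) (h : (G y).det ≠ 0)
    (a b c d : Fin 4) :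
    ∑ e, christoffelLow G e a b y * christoffel G e c d y
      = ∑ e, christoffelLow G e c d y * christoffel G e a b y := by
  simp only [← sum_christoffel h, Finset.sum_mul]
  rw [Finset.sum_comm]
  refine Finset.sum_congr rfl fun e _ => Finset.sum_congr rfl fun f _ => ?_
  rw [hG y e f]
  ring

theorem riemann_antisymm_right (a b c d : Fin 4) : riemann G y a b c d = -riemann G y a b d c := by
  simp only [riemann, ← Finset.sum_neg_distrib]
  refine Finset.sum_congr rfl fun e _ => ?_
  simp only [riemannUp]
  ring

theorem riemann_bianchi (hG : ∀ z i j, G z i j = G z j i) (a b c d : Fin 4) :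
    riemann G y a b c d + riemann G y a c d b + riemann G y a d b c = 0 := by
  simp only [riemann, ← Finset.sum_add_distrib]
  refine Finset.sum_eq_zero fun e _ => ?_
  simp only [riemannUp, christoffel_comm hG _ d b, christoffel_comm hG _ c b,
    christoffel_comm hG _ d c]
  ring

theorem riemann_antisymm_left (hs : ∀ i j, ContDiffAt ℝ ∞ (fun z => G z i j) y)
    (hG : ∀ z i j, G z i j = G z j i) (h : (G y).det ≠ 0) (a b c d : Fin 4) :
    riemann G y a b c d = -riemann G y b a c d := by
  rw [riemann_eq hs hG h, riemann_eq hs hG h]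
  simp only [pd_christoffelLow hs]
  rw [sum_low_christoffel_comm hG h c a d b, sum_low_christoffel_comm hG h d a c b,
    pd_comm (hs a b) d c, pd_comm (hs b a) d c]
  simp only [hG _ b a, hG _ d a, hG _ c a, hG _ d b, hG _ c b]
  ring

/-- Combine the four cyclic identities whose indices are shifted cyclically; the two antisymmetries
cancel everything else. -/
theorem pair_symm_of_symmetries {R : Fin 4 → Fin 4 → Fin 4 → Fin 4 → ℝ}
    (h1 : ∀ a b c d, R a b c d = -R b a c d) (h2 : ∀ a b c d, R a b c d = -R a b d c)
    (h3 : ∀ a b c d, R a b c d + R a c d b + R a d b c = 0) (a b c d : Fin 4) :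
    R a b c d = R c d a b := by
  linarith [h3 a b c d, h3 b c d a, h3 c d a b, h3 d a b c, h1 a b c d, h2 a b c d, h1 a c d b,
    h2 a c d b, h1 a d b c, h2 a d b c, h1 b c d a, h2 b c d a, h1 b d a c, h2 b d a c, h1 c d a b,
    h2 c d a b, h1 b a c d, h1 c a b d, h2 c a b d, h1 c b d a, h2 c b d a, h1 d a b c, h2 d a b c,
    h1 d b c a, h2 d b c a, h1 d c a b, h2 d c a b, h1 c a d b, h1 d b a c, h2 c a d b, h2 d b a c]

theorem ricci_eq_trace (h : (G y).det ≠ 0) (b d : Fin 4) :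
    ricci G y b d = ∑ a, ∑ c, (G y)⁻¹ a c * riemann G y c b a d := by
  refine Finset.sum_congr rfl fun a _ => ?_
  have := congrFun (Matrix.mulVec_mulVec (fun e => riemannUp G y e b a d) (G y)⁻¹ (G y)) a
  rw [Matrix.nonsing_inv_mul _ (isUnit_iff_ne_zero.2 h), Matrix.one_mulVec] at this
  simpa only [Matrix.mulVec, dotProduct, riemann] using this.symm

/-- The subtracted terms are built from symmetric tensors and share the symmetries of Riemann. In
dimension four the trace is Ric - (1/2)(4 Ric - 2 Ric + s g) + (s/6)(4g - g) = 0, with s the scalar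
curvature. -/
theorem isWeylTensor_weylTensor (hs : ∀ i j, ContDiffAt ℝ ∞ (fun z => G z i j) y)
    (hG : ∀ z i j, G z i j = G z j i) (h : (G y).det ≠ 0) :
    IsWeylTensor (G y) (weylTensor G y) := by
  have h1 := riemann_antisymm_left hs hG h
  have h2 := riemann_antisymm_right (G := G) (y := y)
  have h3 := riemann_bianchi (y := y) hG
  have h4 := pair_symm_of_symmetries h1 h2 h3
  have hinv : ∀ a c, (G y)⁻¹ a c = (G y)⁻¹ c a := fun a c =>
    (Matrix.IsSymm.ext (A := (G y)) fun i j => hG y j i).inv.apply c a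
  have hric : ∀ b d, ricci G y b d = ricci G y d b := by
    intro b d
    rw [ricci_eq_trace h, ricci_eq_trace h, Finset.sum_comm]
    refine Finset.sum_congr rfl fun a _ => Finset.sum_congr rfl fun c _ => ?_
    rw [hinv, h4]
  have hm : ∀ i j, ∑ c, (G y)⁻¹ i c * G y c j = if i = j then 1 else 0 := by
    intro i j
    have := congrFun (congrFun (Matrix.nonsing_inv_mul (G y) (isUnit_iff_ne_zero.2 h)) i) j
    rwa [Matrix.mul_apply, Matrix.one_apply] at this
  refine ⟨fun a b c d => ?_, fun a b c d => ?_, fun a b c d => ?_, fun a b c d => ?_,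
    fun b d => ?_⟩
  · simp only [weylTensor]
    rw [h1 a b c d]
    ring
  · simp only [weylTensor]
    rw [h2 a b c d]
    ring
  · simp only [weylTensor]
    rw [h4 a b c d, hG y a c, hG y b d, hG y a d, hG y b c, hric b d, hric b c, hric a c, hric a d]
    ring
  · simp only [weylTensor]
    have := h3 a b c d
    rw [hric c b, hric d c, hric d b, hG y d c, hG y c b, hG y d b]
    linarith
  · have t1 : ∑ a, ∑ c, (G y)⁻¹ a c * riemann G y a b c d = ricci G y b d := by
      rw [ricci_eq_trace h, Finset.sum_comm]
      refine Finset.sum_congr rfl fun a _ => Finset.sum_congr rfl fun c _ => ?_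
      rw [hinv]
    have t2 : ∑ a, ∑ c, (G y)⁻¹ a c * G y a c = 4 := by
      calc _ = ∑ a, ∑ c, (G y)⁻¹ a c * G y c a := by simp only [hG y _ _]
        _ = 4 := by simp [hm]
    have t3 : ∑ a, ∑ c, (G y)⁻¹ a c * (G y a d * ricci G y b c) = ricci G y b d := by
      rw [Finset.sum_comm]
      calc _ = ∑ c, (∑ a, (G y)⁻¹ c a * G y a d) * ricci G y b c := by
            simp only [Finset.sum_mul]
            refine Finset.sum_congr rfl fun c _ => Finset.sum_congr rfl fun a _ => ?_
            rw [hinv a c, mul_assoc]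
        _ = _ := by simp [hm]
    have t4 : ∑ a, ∑ c, (G y)⁻¹ a c * (G y b c * ricci G y a d) = ricci G y b d := by
      calc _ = ∑ a, (∑ c, (G y)⁻¹ a c * G y c b) * ricci G y a d := by
            simp only [Finset.sum_mul]
            refine Finset.sum_congr rfl fun c _ => Finset.sum_congr rfl fun a _ => ?_
            rw [hG y b a, mul_assoc]
        _ = _ := by simp [hm]
    have t5 : ∑ a, ∑ c, (G y)⁻¹ a c * (G y a d * G y b c) = G y b d := by
      calc _ = ∑ a, (∑ c, (G y)⁻¹ a c * G y c b) * G y a d := by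
            simp only [Finset.sum_mul]
            refine Finset.sum_congr rfl fun c _ => Finset.sum_congr rfl fun a _ => ?_
            rw [hG y b a]
            ring
        _ = _ := by simp [hm]
    have t6 : ∑ a, ∑ c, (G y)⁻¹ a c * ricci G y a c = scalarCurv G y := rfl
    calc _ = ∑ a, ∑ c, ((G y)⁻¹ a c * riemann G y a b c d
          - (1 / 2) * (((G y)⁻¹ a c * G y a c) * ricci G y b d
            - (G y)⁻¹ a c * (G y a d * ricci G y b c) + ((G y)⁻¹ a c * ricci G y a c) * G y b d
            - (G y)⁻¹ a c * (G y b c * ricci G y a d))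
          + (scalarCurv G y / 6) * (((G y)⁻¹ a c * G y a c) * G y b d
            - (G y)⁻¹ a c * (G y a d * G y b c))) :=
          Finset.sum_congr rfl fun a _ => Finset.sum_congr rfl fun c _ => by
            simp only [weylTensor]
            ring
      _ = 0 := by
          simp only [Finset.sum_add_distrib, Finset.sum_sub_distrib, ← Finset.mul_sum,
            ← Finset.sum_mul, t1, t2, t3, t4, t5, t6]
          ring

end Curvature

end WeylAlign

namespace WeylAlign

open Matrix

open scoped Kronecker

/-! ### Four-index tensors as matrices on pairs of indices, and change of frame. -/

section PairMatrices

variable {R : Type*}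

/-- A tensor with four indices as a matrix indexed by pairs of indices. -/
def pairMat (W : Fin 4 → Fin 4 → Fin 4 → Fin 4 → R) :
    Matrix (Fin 4 × Fin 4) (Fin 4 × Fin 4) R :=
  Matrix.of fun x y => W x.1 x.2 y.1 y.2

theorem pairMat_injective : Function.Injective (pairMat (R := R)) := by
  intro W W' h
  funext a b c d
  exact congrFun (congrFun h (a, b)) (c, d)

/-- A tensor with two indices as a vector indexed by pairs of indices. -/
def flat (F : Matrix (Fin 4) (Fin 4) R) (x : Fin 4 × Fin 4) : R := F x.1 x.2

theorem flat_injective : Function.Injective (flat (R := R)) := by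
  intro F F' h
  ext a b
  exact congrFun h (a, b)

variable [CommRing R]

/-- The tensor product of two vectors. -/
def tens (x y : Fin 4 → R) (p : Fin 4 × Fin 4) : R := x p.1 * y p.2

/-- The components of the tensor `W` in the frame given by the columns of `P`. -/
def pull (P : Matrix (Fin 4) (Fin 4) R) (W : Fin 4 → Fin 4 → Fin 4 → Fin 4 → R)
    (a b c d : Fin 4) : R :=
  ((P ⊗ₖ P)ᵀ * pairMat W * (P ⊗ₖ P)) (a, b) (c, d)

theorem pairMat_pull (P : Matrix (Fin 4) (Fin 4) R) (W : Fin 4 → Fin 4 → Fin 4 → Fin 4 → R) :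
    pairMat (pull P W) = (P ⊗ₖ P)ᵀ * pairMat W * (P ⊗ₖ P) := rfl

theorem pull_eq_sum (P : Matrix (Fin 4) (Fin 4) R) (W : Fin 4 → Fin 4 → Fin 4 → Fin 4 → R)
    (a b c d : Fin 4) : pull P W a b c d
      = ∑ i, ∑ j, ∑ k, ∑ l, P i a * P j b * P k c * P l d * W i j k l := by
  rw [pull, Matrix.mul_assoc, Matrix.mul_apply, Fintype.sum_prod_type]
  refine Finset.sum_congr rfl fun i _ => Finset.sum_congr rfl fun j _ => ?_
  rw [Matrix.mul_apply, Fintype.sum_prod_type, Finset.mul_sum]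
  refine Finset.sum_congr rfl fun k _ => ?_
  rw [Finset.mul_sum]
  refine Finset.sum_congr rfl fun l _ => ?_
  simp only [transpose_apply, kroneckerMap_apply, pairMat, of_apply]
  ring

theorem pull_mul (P L : Matrix (Fin 4) (Fin 4) R) (W : Fin 4 → Fin 4 → Fin 4 → Fin 4 → R) :
    pull (P * L) W = pull L (pull P W) := by
  apply pairMat_injective
  simp only [pairMat_pull, mul_kronecker_mul, transpose_mul, Matrix.mul_assoc]

theorem flat_congr (P F : Matrix (Fin 4) (Fin 4) R) :
    flat (Pᵀ * F * P) = (P ⊗ₖ P)ᵀ *ᵥ flat F := by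
  funext ⟨a, b⟩
  simp only [flat, mulVec, dotProduct, Fintype.sum_prod_type, Matrix.mul_apply, Finset.sum_mul,
    transpose_apply, kroneckerMap_apply]
  rw [Finset.sum_comm]
  refine Finset.sum_congr rfl fun i _ => Finset.sum_congr rfl fun j _ => by ring

theorem kronecker_mulVec_tens (P : Matrix (Fin 4) (Fin 4) R) (x y : Fin 4 → R) :
    (P ⊗ₖ P) *ᵥ tens x y = tens (P *ᵥ x) (P *ᵥ y) := by
  funext ⟨a, b⟩
  simp only [tens, mulVec, dotProduct, Fintype.sum_prod_type, Finset.sum_mul_sum,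
    kroneckerMap_apply]
  refine Finset.sum_congr rfl fun i _ => Finset.sum_congr rfl fun j _ => by ring

theorem matrix_ext_dotProduct {A B : Matrix (Fin 4) (Fin 4) R}
    (h : ∀ x y : Fin 4 → R, x ⬝ᵥ A *ᵥ y = x ⬝ᵥ B *ᵥ y) : A = B := by
  ext i j
  simpa using h (Pi.single i 1) (Pi.single j 1)

theorem dotProduct_congr (P A : Matrix (Fin 4) (Fin 4) R) (x y : Fin 4 → R) :
    x ⬝ᵥ (Pᵀ * A * P) *ᵥ y = (P *ᵥ x) ⬝ᵥ A *ᵥ (P *ᵥ y) := by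
  rw [← mulVec_mulVec, ← mulVec_mulVec, dotProduct_mulVec, vecMul_transpose]

end PairMatrices

/-- Reading W as a bilinear form on tensor squares turns the behaviour of W(v;v) under a change of
frame into matrix algebra. -/
theorem dotProduct_contractVec (W : Fin 4 → Fin 4 → Fin 4 → Fin 4 → ℝ) (v x y : Fin 4 → ℝ) :
    x ⬝ᵥ contractVec W v *ᵥ y = tens x v ⬝ᵥ pairMat W *ᵥ tens y v := by
  simp only [dotProduct, mulVec, Fintype.sum_prod_type, contractVec, of_apply, tens, pairMat,
    Finset.mul_sum, Finset.sum_mul]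
  refine Finset.sum_congr rfl fun a _ => ?_
  rw [Finset.sum_comm]
  refine Finset.sum_congr rfl fun b _ => Finset.sum_congr rfl fun c _ =>
    Finset.sum_congr rfl fun d _ => by ring

theorem contractVec_pull (P : Matrix (Fin 4) (Fin 4) ℝ)
    (W : Fin 4 → Fin 4 → Fin 4 → Fin 4 → ℝ) (v : Fin 4 → ℝ) :
    contractVec (pull P W) v = Pᵀ * contractVec W (P *ᵥ v) * P := by
  refine matrix_ext_dotProduct fun x y => ?_
  rw [dotProduct_congr, dotProduct_contractVec, dotProduct_contractVec, pairMat_pull,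
    ← kronecker_mulVec_tens, ← kronecker_mulVec_tens, ← mulVec_mulVec, ← mulVec_mulVec,
    dotProduct_mulVec, vecMul_transpose]

/-! ### Orthonormal frames -/

/-- The columns of `P` form a positively oriented orthonormal frame of the metric `g`. -/
structure IsFrame (g P : Matrix (Fin 4) (Fin 4) ℝ) : Prop where
  congr : Pᵀ * g * P = minkowski
  det_pos : 0 < P.det

theorem minkowski_mul_self : minkowski * minkowski = 1 := by
  rw [minkowski, diagonal_mul_diagonal, ← diagonal_one]
  congr 1
  funext i
  fin_cases i <;> simp

theorem minkowski_inv : minkowski⁻¹ = minkowski := inv_eq_right_inv minkowski_mul_self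

theorem det_minkowski : minkowski.det = -1 := by
  simp [minkowski, det_diagonal, Fin.prod_univ_four]

theorem minkowski_transpose : minkowskiᵀ = minkowski := diagonal_transpose _

section Frame

variable {g P : Matrix (Fin 4) (Fin 4) ℝ}

theorem inv_eq_of_congr (h : Pᵀ * g * P = minkowski) : g⁻¹ = P * minkowski * Pᵀ := by
  have h1 : (minkowski * Pᵀ * g) * P = 1 := by
    rw [Matrix.mul_assoc, Matrix.mul_assoc, ← Matrix.mul_assoc Pᵀ, h, minkowski_mul_self]
  have h2 := mul_eq_one_comm.1 h1
  refine inv_eq_left_inv ?_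
  rw [Matrix.mul_assoc, Matrix.mul_assoc, ← Matrix.mul_assoc minkowski]
  exact h2

theorem det_of_congr (h : Pᵀ * g * P = minkowski) : P.det ^ 2 * g.det = -1 := by
  have := congrArg Matrix.det h
  rw [det_mul, det_mul, det_transpose, det_minkowski] at this
  linarith

namespace IsFrame

theorem isUnit_det (hP : IsFrame g P) : IsUnit P.det := isUnit_iff_ne_zero.2 hP.det_pos.ne'

theorem inv_eq (hP : IsFrame g P) : g⁻¹ = P * minkowski * Pᵀ := inv_eq_of_congr hP.congr

theorem mul (hP : IsFrame g P) {L : Matrix (Fin 4) (Fin 4) ℝ} (hL : IsFrame minkowski L) :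
    IsFrame g (P * L) := by
  refine ⟨?_, by rw [det_mul]; exact mul_pos hP.det_pos hL.det_pos⟩
  rw [transpose_mul, ← hL.congr, ← hP.congr]
  simp only [Matrix.mul_assoc]

/-- The place where orientation enters: the left side is 1/|det P|, and positivity removes the
absolute value. -/
theorem sqrt_det (hP : IsFrame g P) : √|g.det| = (P.det)⁻¹ := by
  have h := det_of_congr hP.congr
  have h0 := hP.det_pos
  have hg : g.det = -((P.det)⁻¹ ^ 2) := by
    field_simp
    linarith
  rw [hg, abs_neg, abs_of_nonneg (sq_nonneg _), Real.sqrt_sq (inv_pos.2 h0).le]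

theorem congr_eq_zero (hP : IsFrame g P) {A : Matrix (Fin 4) (Fin 4) ℝ} :
    Pᵀ * A * P = 0 ↔ A = 0 := by
  have hu : IsUnit P := (isUnit_iff_isUnit_det P).2 hP.isUnit_det
  have hu' : IsUnit Pᵀ := (isUnit_iff_isUnit_det _).2 (by rw [det_transpose]; exact hP.isUnit_det)
  rw [hu.mul_left_eq_zero, hu'.mul_right_eq_zero]

theorem exists_mulVec_eq (hP : IsFrame g P) (v : Fin 4 → ℝ) : ∃ x, v = P *ᵥ x :=
  ⟨P⁻¹ *ᵥ v, by rw [mulVec_mulVec, mul_nonsing_inv _ hP.isUnit_det, one_mulVec]⟩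

theorem mulVec_ne_zero (hP : IsFrame g P) {x : Fin 4 → ℝ} (hx : x ≠ 0) : P *ᵥ x ≠ 0 :=
  fun h => hx <| by
    have := congrArg (P⁻¹ *ᵥ ·) h
    simpa [mulVec_mulVec, nonsing_inv_mul _ hP.isUnit_det] using this

theorem dotProduct (hP : IsFrame g P) (x y : Fin 4 → ℝ) :
    (P *ᵥ x) ⬝ᵥ g *ᵥ (P *ᵥ y) = x ⬝ᵥ minkowski *ᵥ y := by
  rw [← hP.congr, dotProduct_congr]

end IsFrame

/-! ### The volume form and the Hodge dual -/

/-- Turns the sum over functions produced by multilinear expansion into nested index sums. -/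
theorem sum_fin_four {β : Type*} [AddCommMonoid β] (F : (Fin 4 → Fin 4) → β) :
    ∑ f, F f = ∑ i, ∑ j, ∑ k, ∑ l, F ![i, j, k, l] := by
  have h : ∀ (n : ℕ) (H : (Fin (n + 1) → Fin 4) → β),
      ∑ f, H f = ∑ i, ∑ f : Fin n → Fin 4, H (Fin.cons i f) := by
    intro n H
    rw [← (Fin.consEquiv fun _ => Fin 4).sum_comp, Fintype.sum_prod_type]
    rfl
  rw [h]
  refine Finset.sum_congr rfl fun i _ => ?_
  rw [h]
  refine Finset.sum_congr rfl fun j _ => ?_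
  rw [h]
  refine Finset.sum_congr rfl fun k _ => ?_
  rw [h]
  refine Finset.sum_congr rfl fun l _ => ?_
  rw [Fintype.sum_unique]
  rfl

theorem pull_leviCivita (P : Matrix (Fin 4) (Fin 4) ℝ) (a b c d : Fin 4) :
    pull P leviCivita a b c d = P.det * leviCivita a b c d := by
  -- Left multiplication by `N` selects the rows a, b, c, d of Pᵀ. Multiplicativity of the
  -- determinant and its multilinear expansion in rows compute the same number.
  set N : Matrix (Fin 4) (Fin 4) ℝ :=
    Matrix.of fun i j : Fin 4 => if ![a, b, c, d] i = j then (1 : ℝ) else 0 with hN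
  have h1 : P.det * leviCivita a b c d = (N * Pᵀ).det := by
    rw [det_mul, det_transpose, mul_comm]
    rfl
  have h2 : N * Pᵀ = fun r => ∑ i, P i (![a, b, c, d] r) • (Pi.single i 1 : Fin 4 → ℝ) := by
    funext r j
    simp [hN, Matrix.mul_apply, Finset.sum_apply, Pi.single_apply]
  rw [h1, h2]
  change _ = (detRowAlternating : (Fin 4 → ℝ) [⋀^Fin 4]→ₗ[ℝ] ℝ).toMultilinearMap _
  rw [MultilinearMap.map_sum, sum_fin_four, pull_eq_sum]
  refine Finset.sum_congr rfl fun i _ => Finset.sum_congr rfl fun j _ =>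
    Finset.sum_congr rfl fun k _ => Finset.sum_congr rfl fun l _ => ?_
  rw [MultilinearMap.map_smul_univ, Fin.prod_univ_four, smul_eq_mul]
  congr 1
  rw [leviCivita]
  congr 1
  funext r s
  simp [Pi.single_apply, eq_comm]

theorem pull_volForm (hP : IsFrame g P) : pull P (volForm g) = volForm minkowski := by
  funext a b c d
  have h : pull P (volForm g) a b c d = √|g.det| * pull P leviCivita a b c d := by
    simp only [pull_eq_sum, Finset.mul_sum, volForm]
    refine Finset.sum_congr rfl fun i _ => Finset.sum_congr rfl fun j _ =>
      Finset.sum_congr rfl fun k _ => Finset.sum_congr rfl fun l _ => by ring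
  rw [h, pull_leviCivita, hP.sqrt_det, volForm, det_minkowski, inv_mul_cancel_left₀ hP.det_pos.ne']
  simp

theorem pairMat_volFormUp (g : Matrix (Fin 4) (Fin 4) ℝ) :
    pairMat (volFormUp g) = pairMat (volForm g) * (g⁻¹ ⊗ₖ g⁻¹) := by
  ext ⟨a, b⟩ ⟨c, d⟩
  simp only [pairMat, of_apply, volFormUp, Matrix.mul_apply, Fintype.sum_prod_type,
    kroneckerMap_apply, mul_assoc]

theorem inv_kronecker (hP : IsFrame g P) : g⁻¹ ⊗ₖ g⁻¹ =
    (P ⊗ₖ P) * (minkowski ⊗ₖ minkowski) * (P ⊗ₖ P)ᵀ := by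
  rw [hP.inv_eq, ← kroneckerMap_transpose, ← mul_kronecker_mul, ← mul_kronecker_mul]

/-- The Hodge operator commutes with passage to an oriented orthonormal frame; all covariance of
duals rests on this. -/
theorem pairMat_volFormUp_comm (hP : IsFrame g P) :
    pairMat (volFormUp minkowski) * (P ⊗ₖ P)ᵀ = (P ⊗ₖ P)ᵀ * pairMat (volFormUp g) := by
  rw [pairMat_volFormUp, pairMat_volFormUp, minkowski_inv, inv_kronecker hP, ← pull_volForm hP,
    pairMat_pull]
  simp only [Matrix.mul_assoc]

theorem pairMat_dualTensor (g : Matrix (Fin 4) (Fin 4) ℝ)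
    (W : Fin 4 → Fin 4 → Fin 4 → Fin 4 → ℝ) :
    pairMat (dualTensor g W) = (1 / 2 : ℝ) • (pairMat (volFormUp g) * pairMat W) := by
  ext ⟨a, b⟩ ⟨c, d⟩
  simp only [pairMat, of_apply, dualTensor, Matrix.mul_apply, Fintype.sum_prod_type,
    Matrix.smul_apply, smul_eq_mul]

theorem dualTensor_pull (hP : IsFrame g P) (W : Fin 4 → Fin 4 → Fin 4 → Fin 4 → ℝ) :
    dualTensor minkowski (pull P W) = pull P (dualTensor g W) := by
  apply pairMat_injective
  rw [pairMat_dualTensor, pairMat_pull, pairMat_pull, pairMat_dualTensor, ← Matrix.mul_assoc,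
    ← Matrix.mul_assoc, pairMat_volFormUp_comm hP]
  simp only [Matrix.mul_assoc, Matrix.smul_mul, Matrix.mul_smul]

theorem magnetic_pull (hP : IsFrame g P) (W : Fin 4 → Fin 4 → Fin 4 → Fin 4 → ℝ)
    (v : Fin 4 → ℝ) :
    magnetic minkowski (pull P W) v = Pᵀ * magnetic g W (P *ᵥ v) * P := by
  rw [magnetic, dualTensor_pull hP, contractVec_pull, magnetic]

/-! ### Complex two-forms -/

/-- The complexification of a real matrix. -/
abbrev cplx {m n : Type*} (A : Matrix m n ℝ) : Matrix m n ℂ := A.map Complex.ofRealHom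

theorem cplx_mul {m n o : Type*} [Fintype n] (A : Matrix m n ℝ) (B : Matrix n o ℝ) :
    cplx (A * B) = cplx A * cplx B := Matrix.map_mul

theorem cplx_kronecker (A B : Matrix (Fin 4) (Fin 4) ℝ) :
    cplx (A ⊗ₖ B) = cplx A ⊗ₖ cplx B := by
  ext
  simp

/-- The components of the two-form `F` in the frame given by the columns of `P`. -/
def pullForm (P : Matrix (Fin 4) (Fin 4) ℝ) (F : Matrix (Fin 4) (Fin 4) ℂ) :
    Matrix (Fin 4) (Fin 4) ℂ := (cplx P)ᵀ * F * cplx P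

theorem flat_pullForm (F : Matrix (Fin 4) (Fin 4) ℂ) :
    flat (pullForm P F) = cplx (P ⊗ₖ P)ᵀ *ᵥ flat F := by
  rw [pullForm, flat_congr, ← cplx_kronecker, cplx, cplx, transpose_map]

theorem flat_dualForm (g : Matrix (Fin 4) (Fin 4) ℝ) (F : Matrix (Fin 4) (Fin 4) ℂ) :
    flat (dualForm g F) = (1 / 2 : ℂ) • (cplx (pairMat (volFormUp g)) *ᵥ flat F) := by
  funext ⟨a, b⟩
  simp [flat, dualForm, mulVec, _root_.dotProduct, Fintype.sum_prod_type, pairMat]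

theorem dualForm_pullForm (hP : IsFrame g P) (F : Matrix (Fin 4) (Fin 4) ℂ) :
    dualForm minkowski (pullForm P F) = pullForm P (dualForm g F) := by
  apply flat_injective
  rw [flat_dualForm, flat_pullForm, flat_pullForm, flat_dualForm, mulVec_mulVec, ← cplx_mul,
    pairMat_volFormUp_comm hP, cplx_mul, ← mulVec_mulVec, mulVec_smul]

theorem pullForm_injective (hP : IsFrame g P) : Function.Injective (pullForm P) := by
  have h : cplx P * cplx P⁻¹ = 1 := by
    rw [← cplx_mul, mul_nonsing_inv _ hP.isUnit_det]
    simp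
  have h' : (cplx P⁻¹)ᵀ * (cplx P)ᵀ = 1 := by
    rw [← transpose_mul, h, transpose_one]
  intro F F' hF
  have : ∀ F, (cplx P⁻¹)ᵀ * pullForm P F * cplx P⁻¹ = F := by
    intro F
    rw [pullForm, Matrix.mul_assoc, Matrix.mul_assoc, Matrix.mul_assoc, h, Matrix.mul_one,
      ← Matrix.mul_assoc, h', Matrix.one_mul]
  rw [← this F, hF, this F']

theorem pullForm_surjective (hP : IsFrame g P) : Function.Surjective (pullForm P) := by
  have h : cplx P⁻¹ * cplx P = 1 := by
    rw [← cplx_mul, nonsing_inv_mul _ hP.isUnit_det]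
    simp
  have h' : (cplx P)ᵀ * (cplx P⁻¹)ᵀ = 1 := by
    rw [← transpose_mul, h, transpose_one]
  intro F
  refine ⟨(cplx P⁻¹)ᵀ * F * cplx P⁻¹, ?_⟩
  rw [pullForm, Matrix.mul_assoc, Matrix.mul_assoc, Matrix.mul_assoc, h, Matrix.mul_one,
      ← Matrix.mul_assoc, h', Matrix.one_mul]

theorem pullForm_smul (c : ℂ) (F : Matrix (Fin 4) (Fin 4) ℂ) :
    pullForm P (c • F) = c • pullForm P F := by
  simp only [pullForm, Matrix.mul_smul, Matrix.smul_mul]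

theorem pullForm_sub (F F' : Matrix (Fin 4) (Fin 4) ℂ) :
    pullForm P (F - F') = pullForm P F - pullForm P F' := by
  simp only [pullForm, Matrix.mul_sub, Matrix.sub_mul]

theorem antisymm_iff_transpose (F : Matrix (Fin 4) (Fin 4) ℂ) :
    (∀ a b, F a b = -F b a) ↔ F = -Fᵀ :=
  ⟨fun h => Matrix.ext h, fun h a b => congrFun (congrFun h a) b⟩

theorem isBivector_pullForm (hP : IsFrame g P) (F : Matrix (Fin 4) (Fin 4) ℂ) :
    IsBivector minkowski (pullForm P F) ↔ IsBivector g F := by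
  have ht : (pullForm P F)ᵀ = pullForm P Fᵀ := by
    simp only [pullForm, transpose_mul, transpose_transpose, Matrix.mul_assoc]
  have hn : -pullForm P Fᵀ = pullForm P (-Fᵀ) := by
    simp only [pullForm, Matrix.mul_neg, Matrix.neg_mul]
  rw [IsBivector, IsBivector, antisymm_iff_transpose, antisymm_iff_transpose, ht, hn,
    dualForm_pullForm hP, ← pullForm_smul, (pullForm_injective hP).eq_iff,
    (pullForm_injective hP).eq_iff]

theorem pairMat_selfDualTensor (g : Matrix (Fin 4) (Fin 4) ℝ)
    (W : Fin 4 → Fin 4 → Fin 4 → Fin 4 → ℝ) :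
    pairMat (selfDualTensor g W) = (1 / 2 : ℂ) • (cplx (pairMat W)
      - Complex.I • cplx (pairMat (dualTensor g W))) := rfl

theorem flat_weylMap (g : Matrix (Fin 4) (Fin 4) ℝ) (W : Fin 4 → Fin 4 → Fin 4 → Fin 4 → ℝ)
    (F : Matrix (Fin 4) (Fin 4) ℂ) :
    flat (weylMap g W F) = (1 / 2 : ℂ) • (pairMat (selfDualTensor g W) *ᵥ
      (cplx (g⁻¹ ⊗ₖ g⁻¹) *ᵥ flat F)) := by
  funext ⟨a, b⟩
  rw [mulVec_mulVec]
  simp only [flat, weylMap, of_apply, mulVec, _root_.dotProduct, Fintype.sum_prod_type, pairMat,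
    Pi.smul_apply, smul_eq_mul, Matrix.mul_apply, Finset.sum_mul, map_apply, kroneckerMap_apply]
  refine congrArg ((1 / 2 : ℂ) * ·) ?_
  refine Finset.sum_congr rfl fun c _ => Finset.sum_congr rfl fun d _ =>
    Finset.sum_congr rfl fun e _ => Finset.sum_congr rfl fun f _ => ?_
  simp only [Complex.ofRealHom_eq_coe, Complex.ofReal_mul]
  ring

theorem weylMap_pullForm (hP : IsFrame g P) (W : Fin 4 → Fin 4 → Fin 4 → Fin 4 → ℝ)
    (F : Matrix (Fin 4) (Fin 4) ℂ) :
    weylMap minkowski (pull P W) (pullForm P F) = pullForm P (weylMap g W F) := by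
  have h : pairMat (selfDualTensor minkowski (pull P W))
      = cplx (P ⊗ₖ P)ᵀ * pairMat (selfDualTensor g W) * cplx (P ⊗ₖ P) := by
    rw [pairMat_selfDualTensor, pairMat_selfDualTensor, dualTensor_pull hP, pairMat_pull,
      pairMat_pull, cplx_mul, cplx_mul, cplx_mul, cplx_mul]
    simp only [Matrix.mul_smul, Matrix.smul_mul, Matrix.mul_sub, Matrix.sub_mul]
  apply flat_injective
  rw [flat_weylMap, flat_pullForm, flat_pullForm, flat_weylMap, h, minkowski_inv,
    inv_kronecker hP, cplx_mul, cplx_mul, mulVec_smul]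
  simp only [mulVec_mulVec, Matrix.mul_assoc]

theorem isEigenbivector_pullForm (hP : IsFrame g P) (W : Fin 4 → Fin 4 → Fin 4 → Fin 4 → ℝ)
    (ρ : ℂ) (F : Matrix (Fin 4) (Fin 4) ℂ) :
    IsEigenbivector minkowski (pull P W) ρ (pullForm P F) ↔ IsEigenbivector g W ρ F := by
  have h0 : pullForm P 0 = 0 := by simp [pullForm]
  rw [IsEigenbivector, IsEigenbivector, isBivector_pullForm hP, weylMap_pullForm hP,
    ← pullForm_smul, (pullForm_injective hP).eq_iff, ne_eq, ne_eq,
    ← (pullForm_injective hP).eq_iff (a := F) (b := 0), h0]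

theorem lower_eq (g : Matrix (Fin 4) (Fin 4) ℝ) (v : Fin 4 → ℝ) : lower g v = g *ᵥ v := rfl

theorem lower_frame (hP : IsFrame g P) (v : Fin 4 → ℝ) :
    lower minkowski v = Pᵀ *ᵥ lower g (P *ᵥ v) := by
  simp only [lower_eq, ← hP.congr, mulVec_mulVec, Matrix.mul_assoc]

theorem pullForm_cplx (A : Matrix (Fin 4) (Fin 4) ℝ) :
    pullForm P (cplx A) = cplx (Pᵀ * A * P) := by
  rw [pullForm, cplx_mul, cplx_mul]
  rfl

theorem vecMulVec_frame (x y : Fin 4 → ℝ) :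
    vecMulVec (Pᵀ *ᵥ x) (Pᵀ *ᵥ y) = Pᵀ * vecMulVec x y * P := by
  rw [mul_vecMulVec, vecMulVec_mul, mulVec_transpose P y]

theorem bivectorOf_eq (g : Matrix (Fin 4) (Fin 4) ℝ) (v w : Fin 4 → ℝ) :
    bivectorOf g v w = ((1 / √2 : ℝ) : ℂ) •
      (cplx (vecMulVec (lower g v) (lower g w) - vecMulVec (lower g w) (lower g v))
        - Complex.I • dualForm g
          (cplx (vecMulVec (lower g v) (lower g w) - vecMulVec (lower g w) (lower g v)))) := by
  have h : cplx (vecMulVec (lower g v) (lower g w) - vecMulVec (lower g w) (lower g v))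
      = Matrix.of fun a b => ((lower g v a * lower g w b - lower g v b * lower g w a : ℝ) : ℂ) := by
    ext a b
    simp [vecMulVec_apply, mul_comm]
  rw [h, bivectorOf]

theorem bivectorOf_frame (hP : IsFrame g P) (v w : Fin 4 → ℝ) :
    bivectorOf minkowski v w = pullForm P (bivectorOf g (P *ᵥ v) (P *ᵥ w)) := by
  have h : vecMulVec (lower minkowski v) (lower minkowski w)
        - vecMulVec (lower minkowski w) (lower minkowski v)
      = Pᵀ * (vecMulVec (lower g (P *ᵥ v)) (lower g (P *ᵥ w))
        - vecMulVec (lower g (P *ᵥ w)) (lower g (P *ᵥ v))) * P := by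
    rw [lower_frame hP, lower_frame hP, vecMulVec_frame, vecMulVec_frame, Matrix.mul_sub,
      Matrix.sub_mul]
  rw [bivectorOf_eq, bivectorOf_eq, h, ← pullForm_cplx, dualForm_pullForm hP, pullForm_smul,
    pullForm_sub, pullForm_smul]

/-! ### Invariance of the symmetries -/

theorem IsWeylTensor.pull {W : Fin 4 → Fin 4 → Fin 4 → Fin 4 → ℝ} (hW : IsWeylTensor g W)
    (hP : IsFrame g P) : IsWeylTensor minkowski (pull P W) := by
  refine ⟨fun a b c d => ?_, fun a b c d => ?_, fun a b c d => ?_, fun a b c d => ?_,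
    fun b d => ?_⟩
  · rw [pull_eq_sum, pull_eq_sum, Finset.sum_comm]
    simp only [← Finset.sum_neg_distrib]
    refine Finset.sum_congr rfl fun i _ => Finset.sum_congr rfl fun j _ =>
      Finset.sum_congr rfl fun k _ => Finset.sum_congr rfl fun l _ => ?_
    rw [hW.antisymm_left j i]
    ring
  · rw [pull_eq_sum, pull_eq_sum]
    simp only [← Finset.sum_neg_distrib]
    refine Finset.sum_congr rfl fun i _ => Finset.sum_congr rfl fun j _ => ?_
    rw [Finset.sum_comm]
    refine Finset.sum_congr rfl fun k _ => Finset.sum_congr rfl fun l _ => ?_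
    rw [hW.antisymm_right i j l k]
    ring
  · have h : (pairMat W)ᵀ = pairMat W := Matrix.ext fun x y => hW.pair_symm _ _ _ _
    have : (pairMat (WeylAlign.pull P W))ᵀ = pairMat (WeylAlign.pull P W) := by
      rw [pairMat_pull, transpose_mul, transpose_mul, h, transpose_transpose, Matrix.mul_assoc]
    exact congrFun (congrFun this (c, d)) (a, b)
  · have h1 : WeylAlign.pull P W a c d b
        = ∑ i, ∑ j, ∑ k, ∑ l, P i a * P j b * P k c * P l d * W i k l j := by
      rw [pull_eq_sum]
      refine Finset.sum_congr rfl fun i _ => ?_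
      calc _ = ∑ k, ∑ j, ∑ l, P i a * P k c * P l d * P j b * W i k l j :=
            Finset.sum_congr rfl fun k _ => Finset.sum_comm
        _ = _ := by
            rw [Finset.sum_comm]
            refine Finset.sum_congr rfl fun j _ => Finset.sum_congr rfl fun k _ =>
              Finset.sum_congr rfl fun l _ => by ring
    have h2 : WeylAlign.pull P W a d b c
        = ∑ i, ∑ j, ∑ k, ∑ l, P i a * P j b * P k c * P l d * W i l j k := by
      rw [pull_eq_sum]
      refine Finset.sum_congr rfl fun i _ => ?_
      rw [Finset.sum_comm]
      refine Finset.sum_congr rfl fun j _ => ?_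
      rw [Finset.sum_comm]
      refine Finset.sum_congr rfl fun k _ => Finset.sum_congr rfl fun l _ => by ring
    rw [h1, h2, pull_eq_sum]
    simp only [← Finset.sum_add_distrib, ← mul_add, hW.bianchi, mul_zero, Finset.sum_const_zero]
  -- The trace to be killed is that of η PᵀAP, with η the Minkowski matrix. Cyclicity turns it into
  -- the trace of PηPᵀA, and PηPᵀ is the inverse metric.
  · set A : Matrix (Fin 4) (Fin 4) ℝ :=
      Matrix.of fun i k => ∑ j, ∑ l, P j b * P l d * W i j k l with hA
    have h1 : ∀ a c, WeylAlign.pull P W a b c d = (Pᵀ * A * P) a c := by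
      intro a c
      rw [pull_eq_sum, Matrix.mul_apply]
      calc _ = ∑ i, ∑ k, ∑ j, ∑ l, P i a * P j b * P k c * P l d * W i j k l :=
            Finset.sum_congr rfl fun i _ => Finset.sum_comm
        _ = ∑ k, ∑ i, ∑ j, ∑ l, P i a * P j b * P k c * P l d * W i j k l := Finset.sum_comm
        _ = _ := by
            refine Finset.sum_congr rfl fun k _ => ?_
            rw [Matrix.mul_apply, Finset.sum_mul]
            refine Finset.sum_congr rfl fun i _ => ?_
            simp only [hA, of_apply, transpose_apply, Finset.mul_sum, Finset.sum_mul]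
            refine Finset.sum_congr rfl fun j _ => Finset.sum_congr rfl fun l _ => by ring
    have h2 : ∀ B C : Matrix (Fin 4) (Fin 4) ℝ, ∑ a, ∑ c, B a c * C a c = (Bᵀ * C).trace := by
      intro B C
      simp only [Matrix.trace, Matrix.mul_apply, diag_apply, transpose_apply]
      rw [Finset.sum_comm]
    simp only [h1]
    rw [h2, minkowski_inv, minkowski_transpose, ← Matrix.mul_assoc, trace_mul_comm,
      ← Matrix.mul_assoc, ← Matrix.mul_assoc]
    have h3 : (g⁻¹)ᵀ = P * minkowski * Pᵀ := by
      rw [hP.inv_eq, transpose_mul, transpose_mul, transpose_transpose, minkowski_transpose,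
        Matrix.mul_assoc]
    rw [← h3, ← h2]
    calc _ = ∑ a, ∑ j, ∑ c, ∑ l, g⁻¹ a c * (P j b * P l d * W a j c l) := by
          simp only [hA, of_apply, Finset.mul_sum]
          exact Finset.sum_congr rfl fun a _ => Finset.sum_comm
      _ = ∑ j, ∑ l, ∑ a, ∑ c, g⁻¹ a c * (P j b * P l d * W a j c l) := by
          rw [Finset.sum_comm]
          refine Finset.sum_congr rfl fun j _ => ?_
          refine Eq.trans (Finset.sum_congr rfl fun a _ => Finset.sum_comm) Finset.sum_comm
      _ = ∑ j, ∑ l, P j b * P l d * ∑ a, ∑ c, g⁻¹ a c * W a j c l := by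
          refine Finset.sum_congr rfl fun j _ => Finset.sum_congr rfl fun l _ => ?_
          simp only [Finset.mul_sum]
          refine Finset.sum_congr rfl fun a _ => Finset.sum_congr rfl fun c _ => by ring
      _ = 0 := by simp only [hW.trace, mul_zero, Finset.sum_const_zero]

end Frame

open scoped Kronecker

/-! ### Two-forms and Weyl tensors through electric and magnetic parts. -/

section RForm

variable {R : Type*} [CommRing R]

/-- The two-form with electric part `x` and magnetic part `y` in a Minkowski frame. -/
def rform (x y : Fin 3 → R) : Matrix (Fin 4) (Fin 4) R :=
  !![0, -x 0, -x 1, -x 2; x 0, 0, y 2, -y 1; x 1, -y 2, 0, y 0; x 2, y 1, -y 0, 0]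

theorem rform_eq_of_antisymm [CharZero R] [NoZeroDivisors R] {F : Matrix (Fin 4) (Fin 4) R}
    (h : ∀ a b, F a b = -F b a) :
    F = rform ![F 1 0, F 2 0, F 3 0] ![F 2 3, F 3 1, F 1 2] := by
  have h0 : ∀ a, F a a = 0 := fun a => self_eq_neg.1 (h a a)
  ext a b
  fin_cases a <;> fin_cases b <;> simp [rform, h0]
  all_goals exact h _ _

theorem rform_smul (c : R) (x y : Fin 3 → R) : rform (c • x) (c • y) = c • rform x y := by
  ext a b
  fin_cases a <;> fin_cases b <;> simp [rform]

theorem rform_add (x y x' y' : Fin 3 → R) :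
    rform (x + x') (y + y') = rform x y + rform x' y' := by
  ext a b
  fin_cases a <;> fin_cases b <;> simp [rform] <;> ring

theorem rform_injective {x y x' y' : Fin 3 → R} (h : rform x y = rform x' y') :
    x = x' ∧ y = y' := by
  have h' : ∀ a b, rform x y a b = rform x' y' a b := fun a b => by rw [h]
  constructor
  · funext i
    fin_cases i
    · simpa [rform] using h' 1 0
    · simpa [rform] using h' 2 0
    · simpa [rform] using h' 3 0
  · funext i
    fin_cases i
    · simpa [rform] using h' 2 3
    · simpa [rform] using h' 3 1
    · simpa [rform] using h' 1 2

/-- The tensor with the symmetries of the Weyl tensor whose electric and magnetic parts in a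
Minkowski frame are `E` and `B`. -/
def ofEB (E B : Matrix (Fin 3) (Fin 3) R) (a b c d : Fin 4) : R :=
  rform (fun i => rform (E i) (-B i) c d) (fun i => rform (-B i) (-E i) c d) a b

theorem ofEB_add (E B E' B' : Matrix (Fin 3) (Fin 3) R) (a b c d : Fin 4) :
    ofEB (E + E') (B + B') a b c d = ofEB E B a b c d + ofEB E' B' a b c d := by
  have h1 : ∀ i, rform ((E + E') i) (-(B + B') i) = rform (E i) (-B i) + rform (E' i) (-B' i) := by
    intro i
    rw [← rform_add, ← neg_add]
    rfl
  have h2 : ∀ i, rform (-(B + B') i) (-(E + E') i)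
      = rform (-B i) (-E i) + rform (-B' i) (-E' i) := by
    intro i
    rw [← rform_add, ← neg_add, ← neg_add]
    rfl
  simp only [ofEB, h1, h2, Matrix.add_apply]
  rw [← Matrix.add_apply, ← rform_add]
  rfl

theorem ofEB_smul (r : R) (E B : Matrix (Fin 3) (Fin 3) R) (a b c d : Fin 4) :
    ofEB (r • E) (r • B) a b c d = r * ofEB E B a b c d := by
  have h1 : ∀ i, rform ((r • E) i) (-(r • B) i) = r • rform (E i) (-B i) := by
    intro i
    rw [← rform_smul, smul_neg]
    rfl
  have h2 : ∀ i, rform (-(r • B) i) (-(r • E) i) = r • rform (-B i) (-E i) := by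
    intro i
    rw [← rform_smul, smul_neg, smul_neg]
    rfl
  simp only [ofEB, h1, h2, Matrix.smul_apply]
  rw [← smul_eq_mul, ← Matrix.smul_apply, ← rform_smul]
  rfl

end RForm

/-! ### The Hodge dual in a Minkowski frame -/

theorem det_four {R : Type*} [CommRing R] (A : Matrix (Fin 4) (Fin 4) R) : A.det =
    A 0 0 * (A 1 1 * (A 2 2 * A 3 3 - A 2 3 * A 3 2) - A 1 2 * (A 2 1 * A 3 3 - A 2 3 * A 3 1)
      + A 1 3 * (A 2 1 * A 3 2 - A 2 2 * A 3 1))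
    - A 0 1 * (A 1 0 * (A 2 2 * A 3 3 - A 2 3 * A 3 2) - A 1 2 * (A 2 0 * A 3 3 - A 2 3 * A 3 0)
      + A 1 3 * (A 2 0 * A 3 2 - A 2 2 * A 3 0))
    + A 0 2 * (A 1 0 * (A 2 1 * A 3 3 - A 2 3 * A 3 1) - A 1 1 * (A 2 0 * A 3 3 - A 2 3 * A 3 0)
      + A 1 3 * (A 2 0 * A 3 1 - A 2 1 * A 3 0))
    - A 0 3 * (A 1 0 * (A 2 1 * A 3 2 - A 2 2 * A 3 1) - A 1 1 * (A 2 0 * A 3 2 - A 2 2 * A 3 0)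
      + A 1 2 * (A 2 0 * A 3 1 - A 2 1 * A 3 0)) := by
  rw [det_succ_row_zero]
  simp [Fin.sum_univ_succ, det_fin_three, Fin.succAbove]
  ring

/-- Passing to integers, with the determinant as an explicit polynomial, lets `decide` settle the
256 index choices. -/
theorem leviCivita_eq (a b c d : Fin 4) : leviCivita a b c d =
    ((rform (fun i => rform (0 : Fin 3 → ℤ) (-Pi.single i 1) c d)
      (fun i => rform (-Pi.single i 1) 0 c d) a b : ℤ) : ℝ) := by
  have h : leviCivita a b c d =
      ((Matrix.of fun i j : Fin 4 => if ![a, b, c, d] i = j then (1 : ℤ) else 0).det : ℝ) := by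
    rw [leviCivita, Int.cast_det]
    congr 1
    ext i j
    simp
  rw [h, det_four]
  congr 1
  clear h
  revert a b c d
  simp only [rform, of_apply]
  decide

/-- The integer components of `η_{ab}{}^{cd}` in a Minkowski frame. -/
def hodgeCoeff (a b c d : Fin 4) : ℤ :=
  rform (fun i => rform 0 (-Pi.single i 1) c d) (fun i => rform (Pi.single i 1) 0 c d) a b

theorem volFormUp_minkowski (a b c d : Fin 4) :
    volFormUp minkowski a b c d = (hodgeCoeff a b c d : ℝ) := by
  have h : volFormUp minkowski a b c d
      = leviCivita a b c d * ((![-1, 1, 1, 1] c : ℤ) : ℝ) * ((![-1, 1, 1, 1] d : ℤ) : ℝ) := by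
    have hs : ∀ i : Fin 4, (![-1, 1, 1, 1] i : ℝ) = ((![-1, 1, 1, 1] i : ℤ) : ℝ) := by
      intro i
      fin_cases i <;> simp
    simp only [volFormUp, minkowski_inv, volForm, det_minkowski]
    simp [minkowski, diagonal_apply, hs]
  rw [h, leviCivita_eq, ← Int.cast_mul, ← Int.cast_mul]
  congr 1
  clear h
  revert a b c d
  simp only [hodgeCoeff, rform, of_apply]
  decide

/-- Over a general field, so that it serves both real Weyl tensors and complex two-forms. -/
theorem sum_hodgeCoeff {K : Type*} [Field K] [CharZero K] (x y : Fin 3 → K) (a b : Fin 4) :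
    (1 / 2 : K) * ∑ c, ∑ d, (hodgeCoeff a b c d : K) * rform x y c d = rform (-y) x a b := by
  fin_cases a <;> fin_cases b <;> simp [Fin.sum_univ_succ, hodgeCoeff, rform] <;> ring

theorem dualForm_rform (x y : Fin 3 → ℂ) :
    dualForm minkowski (rform x y) = rform (-y) x := by
  ext a b
  rw [← sum_hodgeCoeff]
  simp only [dualForm, of_apply, volFormUp_minkowski, Complex.ofReal_intCast]

theorem isBivector_rform (f : Fin 3 → ℂ) : IsBivector minkowski (rform f (-Complex.I • f)) := by
  refine ⟨fun a b => ?_, ?_⟩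
  · fin_cases a <;> fin_cases b <;> simp [rform]
  · rw [dualForm_rform, ← rform_smul, smul_smul]
    simp

/-- The equation *F = iF reads (-y, x) = i(x, y), so y = -ix: a bivector is its electric part, a
vector of ℂ³. -/
theorem exists_rform_of_isBivector {F : Matrix (Fin 4) (Fin 4) ℂ} (h : IsBivector minkowski F) :
    F = rform ![F 1 0, F 2 0, F 3 0] (-Complex.I • ![F 1 0, F 2 0, F 3 0]) := by
  obtain ⟨h1, h2⟩ := h
  have h3 := rform_eq_of_antisymm h1
  rw [h3, dualForm_rform, ← rform_smul] at h2
  have h4 := (rform_injective h2).2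
  conv_lhs => rw [h3]
  congr 1
  rw [h4, smul_smul]
  simp

theorem dualTensor_ofEB_apply (E B : Matrix (Fin 3) (Fin 3) ℝ) (a b c d : Fin 4) :
    dualTensor minkowski (ofEB E B) a b c d
      = rform (-fun i => rform (-B i) (-E i) c d) (fun i => rform (E i) (-B i) c d) a b := by
  have h : ∀ e f, ofEB E B e f c d
    = rform (fun i => rform (E i) (-B i) c d) (fun i => rform (-B i) (-E i) c d) e f :=
    fun _ _ => rfl
  simp only [dualTensor, volFormUp_minkowski, h]
  rw [sum_hodgeCoeff]

/-- In terms of Q = E - iB, duality is multiplication by i. -/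
theorem dualTensor_ofEB (E B : Matrix (Fin 3) (Fin 3) ℝ) :
    dualTensor minkowski (ofEB E B) = ofEB B (-E) := by
  funext a b c d
  rw [dualTensor_ofEB_apply, ofEB]
  have h1 : ∀ i, -rform (-B i) (-E i) c d = rform (B i) (-(-E) i) c d := by
    intro i
    have := congrFun (congrFun (rform_smul (-1 : ℝ) (-B i) (-E i)) c) d
    simp only [neg_one_smul, neg_neg, Matrix.neg_apply] at this
    rw [← this]
    congr 1
    exact (neg_neg (E i)).symm
  have h2 : ∀ i, -((-E) i) = E i := fun i => neg_neg (E i)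
  congr 1
  · exact funext h1
  · simp only [h2]

/-- A Weyl tensor in a Minkowski frame is determined by its electric and magnetic parts. -/
theorem IsWeylTensor.exists_ofEB {W : Fin 4 → Fin 4 → Fin 4 → Fin 4 → ℝ}
    (hW : IsWeylTensor minkowski W) : ∃ E B : Matrix (Fin 3) (Fin 3) ℝ,
      E.IsSymm ∧ B.IsSymm ∧ E.trace = 0 ∧ B.trace = 0 ∧ W = ofEB E B := by
  -- Antisymmetry within each pair leaves a 6 × 6 matrix indexed by the pairs 10, 20, 30, 23, 31,
  -- 12.
  have key : ∀ a b c d, W a b c d =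
      rform ![rform ![W 1 0 1 0, W 1 0 2 0, W 1 0 3 0] ![W 1 0 2 3, W 1 0 3 1, W 1 0 1 2] c d,
        rform ![W 2 0 1 0, W 2 0 2 0, W 2 0 3 0] ![W 2 0 2 3, W 2 0 3 1, W 2 0 1 2] c d,
        rform ![W 3 0 1 0, W 3 0 2 0, W 3 0 3 0] ![W 3 0 2 3, W 3 0 3 1, W 3 0 1 2] c d]
        ![rform ![W 2 3 1 0, W 2 3 2 0, W 2 3 3 0] ![W 2 3 2 3, W 2 3 3 1, W 2 3 1 2] c d,
        rform ![W 3 1 1 0, W 3 1 2 0, W 3 1 3 0] ![W 3 1 2 3, W 3 1 3 1, W 3 1 1 2] c d,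
        rform ![W 1 2 1 0, W 1 2 2 0, W 1 2 3 0] ![W 1 2 2 3, W 1 2 3 1, W 1 2 1 2] c d] a b := by
    intro a b c d
    have h1 : ∀ a b, W a b c d = rform ![W a b 1 0, W a b 2 0, W a b 3 0]
        ![W a b 2 3, W a b 3 1, W a b 1 2] c d := fun a b => congrFun (congrFun
      (rform_eq_of_antisymm (F := Matrix.of fun c d => W a b c d)
        fun c d => hW.antisymm_right a b c d) c) d
    have h2 : W a b c d = rform ![W 1 0 c d, W 2 0 c d, W 3 0 c d]
        ![W 2 3 c d, W 3 1 c d, W 1 2 c d] a b := congrFun (congrFun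
      (rform_eq_of_antisymm (F := Matrix.of fun a b => W a b c d)
        fun a b => hW.antisymm_left a b c d) a) b
    rw [h2, h1 1 0, h1 2 0, h1 3 0, h1 2 3, h1 3 1, h1 1 2]
  have htr : ∀ b d, -W 0 b 0 d + W 1 b 1 d + W 2 b 2 d + W 3 b 3 d = 0 := by
    intro b d
    have := hW.trace b d
    rw [minkowski_inv] at this
    simp [minkowski, diagonal_apply, Fin.sum_univ_succ] at this
    simpa [add_assoc] using this
  have d0 : ∀ a c d, W a a c d = 0 := fun a c d => self_eq_neg.1 (hW.antisymm_left a a c d)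
  have d0' : ∀ a b c, W a b c c = 0 := fun a b c => self_eq_neg.1 (hW.antisymm_right a b c c)
  -- The cyclic identity that makes the magnetic part trace-free.
  have hb := hW.bianchi 1 0 2 3
  have t00 := htr 0 0
  have t01 := htr 0 1
  have t02 := htr 0 2
  have t03 := htr 0 3
  have t11 := htr 1 1
  have t12 := htr 1 2
  have t13 := htr 1 3
  have t22 := htr 2 2
  have t23 := htr 2 3
  have t33 := htr 3 3
  simp only [d0, d0', hW.antisymm_left 0, hW.antisymm_right _ _ 0, hW.antisymm_left 3 2,
    hW.antisymm_right _ _ 3 2, hW.antisymm_left 1 3, hW.antisymm_right _ _ 1 3,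
    hW.antisymm_left 2 1, hW.antisymm_right _ _ 2 1] at hb t00 t01 t02 t03 t11 t12 t13 t22 t23 t33
  have p := hW.pair_symm
  simp only [p 2 0 1 0, p 3 0 1 0, p 3 0 2 0, p 2 3 1 0, p 2 3 2 0, p 2 3 3 0, p 3 1 1 0,
    p 3 1 2 0, p 3 1 3 0, p 1 2 1 0, p 1 2 2 0, p 1 2 3 0, p 3 1 2 3, p 1 2 2 3, p 1 2 3 1]
    at hb t00 t01 t02 t03 t11 t12 t13 t22 t23 t33 key
  refine ⟨!![W 1 0 1 0, W 1 0 2 0, W 1 0 3 0; W 1 0 2 0, W 2 0 2 0, W 2 0 3 0;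
      W 1 0 3 0, W 2 0 3 0, W 3 0 3 0],
    -!![W 1 0 2 3, W 1 0 3 1, W 1 0 1 2; W 1 0 3 1, W 2 0 3 1, W 2 0 1 2;
      W 1 0 1 2, W 2 0 1 2, W 3 0 1 2], ?_, ?_, ?_, ?_, ?_⟩
  · ext i j
    fin_cases i <;> fin_cases j <;> rfl
  · ext i j
    fin_cases i <;> fin_cases j <;> rfl
  · simp [Matrix.trace, Fin.sum_univ_succ]
    linarith
  · simp [Matrix.trace, Fin.sum_univ_succ]
    linarith
  · funext a b c d
    -- The trace conditions make the spatial block minus the electric one (`e1` to `e6`) and the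
    -- mixed block symmetric (`e7` to `e9`).
    have e1 : W 2 3 2 3 = -W 1 0 1 0 := by linarith
    have e2 : W 3 1 3 1 = -W 2 0 2 0 := by linarith
    have e3 : W 1 2 1 2 = -W 3 0 3 0 := by linarith
    have e4 : W 2 3 3 1 = -W 1 0 2 0 := by linarith
    have e5 : W 2 3 1 2 = -W 1 0 3 0 := by linarith
    have e6 : W 3 1 1 2 = -W 2 0 3 0 := by linarith
    have e7 : W 2 0 2 3 = W 1 0 3 1 := by linarith
    have e8 : W 3 0 2 3 = W 1 0 1 2 := by linarith
    have e9 : W 3 0 3 1 = W 2 0 1 2 := by linarith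
    rw [key, ofEB, e1, e2, e3, e4, e5, e6, e7, e8, e9]
    congr 1
    · funext i
      fin_cases i <;> (simp; congr 1; ext j; fin_cases j <;> simp)
    · funext i
      fin_cases i <;> (simp; congr 1 <;> (ext j; fin_cases j <;> simp))

/-- The matrix of the self-dual Weyl tensor in a Minkowski frame. -/
def qMat (E B : Matrix (Fin 3) (Fin 3) ℝ) : Matrix (Fin 3) (Fin 3) ℂ :=
  cplx E - Complex.I • cplx B

/-- U - i*U is the bivector whose electric part is x + iy. -/
theorem rform_sub_dual (x y : Fin 3 → ℝ) (a b : Fin 4) :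
    ((rform x y a b : ℝ) : ℂ) - Complex.I * ((rform (-y) x a b : ℝ) : ℂ)
      = rform (fun i => x i + Complex.I * y i)
        (-Complex.I • fun i => x i + Complex.I * y i : Fin 3 → ℂ) a b := by
  fin_cases a <;> fin_cases b <;> apply Complex.ext <;> simp [rform]

theorem selfDualTensor_ofEB (E B : Matrix (Fin 3) (Fin 3) ℝ) (a b c d : Fin 4) :
    selfDualTensor minkowski (ofEB E B) a b c d
      = 1 / 2 * rform (fun i => rform (qMat E B i) (-Complex.I • qMat E B i) c d)
        (-Complex.I • fun i => rform (qMat E B i) (-Complex.I • qMat E B i) c d) a b := by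
  have h : ∀ i, ((rform (E i) (-B i) c d : ℝ) : ℂ) + Complex.I * ((rform (-B i) (-E i) c d : ℝ) : ℂ)
      = rform (qMat E B i) (-Complex.I • qMat E B i) c d := by
    intro i
    fin_cases c <;> fin_cases d <;> apply Complex.ext <;> simp [rform, qMat]
  rw [selfDualTensor, dualTensor_ofEB_apply, ofEB, rform_sub_dual]
  simp only [h]

/-- The electric parts contribute -2 x·f through the time index, and the magnetic parts 2(-i)² x·f.
-/
theorem sum_rform_mul (x f : Fin 3 → ℂ) : ∑ c, ∑ d, ∑ e, ∑ k,
    rform x (-Complex.I • x) e k * (minkowski⁻¹ e c : ℂ) * (minkowski⁻¹ k d : ℂ)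
      * rform f (-Complex.I • f) c d = -4 * (x ⬝ᵥ f) := by
  simp only [minkowski_inv]
  simp [minkowski, diagonal_apply, rform, Fin.sum_univ_succ, dotProduct]
  ring_nf
  simp
  ring

theorem sum_mul_rform {ι R : Type*} [Fintype ι] [CommRing R] (w : ι → R) (x y : ι → Fin 3 → R)
    (a b : Fin 4) : ∑ s, w s * rform (x s) (y s) a b
      = rform (fun i => ∑ s, w s * x s i) (fun i => ∑ s, w s * y s i) a b := by
  fin_cases a <;> fin_cases b <;> simp [rform]

/-- The sign is 1/2 from the map, times 1/2 from the self-dual tensor, times -4 from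
`sum_rform_mul`. -/
theorem weylMap_ofEB (E B : Matrix (Fin 3) (Fin 3) ℝ) (f : Fin 3 → ℂ) :
    weylMap minkowski (ofEB E B) (rform f (-Complex.I • f))
      = rform (-(qMat E B *ᵥ f)) (-Complex.I • -(qMat E B *ᵥ f)) := by
  set w : Fin 4 × Fin 4 × Fin 4 × Fin 4 → ℂ := fun s =>
    (minkowski⁻¹ s.2.2.1 s.1 : ℂ) * (minkowski⁻¹ s.2.2.2 s.2.1 : ℂ)
      * rform f (-Complex.I • f) s.1 s.2.1 with hw
  set x : Fin 4 × Fin 4 × Fin 4 × Fin 4 → Fin 3 → ℂ := fun s i =>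
    rform (qMat E B i) (-Complex.I • qMat E B i) s.2.2.1 s.2.2.2 with hx
  have h : (fun i => ∑ s, w s * x s i) = (-4 : ℂ) • (qMat E B *ᵥ f) := by
    funext i
    rw [Pi.smul_apply, smul_eq_mul, mulVec, ← sum_rform_mul]
    simp only [Fintype.sum_prod_type, hw, hx]
    refine Finset.sum_congr rfl fun c _ => Finset.sum_congr rfl fun d _ =>
      Finset.sum_congr rfl fun e _ => Finset.sum_congr rfl fun k _ => by ring
  have h' : (fun i => ∑ s, w s * (-Complex.I • x s) i)
      = (-4 : ℂ) • (-Complex.I • (qMat E B *ᵥ f)) := by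
    rw [smul_comm, ← h]
    funext i
    simp only [Pi.smul_apply, smul_eq_mul, Finset.mul_sum]
    exact Finset.sum_congr rfl fun s _ => by ring
  ext a b
  have key : weylMap minkowski (ofEB E B) (rform f (-Complex.I • f)) a b
      = 1 / 4 * ∑ s, w s * rform (x s) (-Complex.I • x s) a b := by
    simp only [weylMap, of_apply, selfDualTensor_ofEB, Fintype.sum_prod_type, hw, hx,
      Finset.mul_sum]
    refine Finset.sum_congr rfl fun c _ => Finset.sum_congr rfl fun d _ =>
      Finset.sum_congr rfl fun e _ => Finset.sum_congr rfl fun k _ => ?_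
    ring
  rw [key, sum_mul_rform, h, h', rform_smul, smul_neg, ← neg_one_smul ℂ (qMat E B *ᵥ f),
    ← neg_one_smul ℂ (-Complex.I • _), rform_smul]
  simp only [Matrix.smul_apply, smul_eq_mul]
  ring

/-! ### Contractions with standard vectors, and the Debever equations. -/

/-- The matrix with spatial block `A` and zeros elsewhere. -/
def spatial {R : Type*} [Zero R] (A : Matrix (Fin 3) (Fin 3) R) : Matrix (Fin 4) (Fin 4) R :=
  !![0, 0, 0, 0; 0, A 0 0, A 0 1, A 0 2; 0, A 1 0, A 1 1, A 1 2; 0, A 2 0, A 2 1, A 2 2]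

theorem spatial_injective {R : Type*} [Zero R] : Function.Injective (spatial (R := R)) := by
  intro A A' h
  have h' : ∀ a b, spatial A a b = spatial A' a b := fun a b => by rw [h]
  ext i j
  have := h' i.succ j.succ
  fin_cases i <;> fin_cases j <;> simpa [spatial] using this

theorem contractVec_smul (W : Fin 4 → Fin 4 → Fin 4 → Fin 4 → ℝ) (r : ℝ) (v : Fin 4 → ℝ) :
    contractVec W (r • v) = (r ^ 2) • contractVec W v := by
  ext a c
  simp only [contractVec, of_apply, Matrix.smul_apply, Pi.smul_apply, smul_eq_mul, Finset.mul_sum]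
  refine Finset.sum_congr rfl fun b _ => Finset.sum_congr rfl fun d _ => by ring

theorem contractVec_ofEB_time (E B : Matrix (Fin 3) (Fin 3) ℝ) :
    contractVec (ofEB E B) ![1, 0, 0, 0] = spatial E := by
  ext a c
  fin_cases a <;> fin_cases c <;>
    simp [contractVec, ofEB, rform, spatial, Fin.sum_univ_succ]

/-- The components W_{a1c1} involve only the electric part and off-diagonal magnetic entries. -/
theorem contractVec_ofEB_diagonal (b : Fin 3 → ℝ) :
    contractVec (ofEB 0 (diagonal b)) ![0, 1, 0, 0] = 0 := by
  ext a c
  fin_cases a <;> fin_cases c <;>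
    simp [contractVec, ofEB, rform, Fin.sum_univ_succ]

/-- The condition on the electric and magnetic parts that `e₀ + e₃` is a multiple Debever
vector. -/
def IsDebeverEB (E B : Matrix (Fin 3) (Fin 3) ℝ) : Prop :=
  E 0 2 + B 1 2 = 0 ∧ E 1 2 - B 0 2 = 0 ∧ E 0 0 - E 1 1 + 2 * B 0 1 = 0 ∧
    2 * E 0 1 - B 0 0 + B 1 1 = 0

theorem contractVec_ofEB_null {E B : Matrix (Fin 3) (Fin 3) ℝ} (hE : E.IsSymm) (hB : B.IsSymm) :
    contractVec (ofEB E B) ![1, 0, 0, 1] =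
      !![E 2 2, -(E 0 2 + B 1 2), -(E 1 2 - B 0 2), -E 2 2;
        -(E 0 2 + B 1 2), E 0 0 - E 1 1 + 2 * B 0 1, 2 * E 0 1 - B 0 0 + B 1 1, E 0 2 + B 1 2;
        -(E 1 2 - B 0 2), 2 * E 0 1 - B 0 0 + B 1 1, -(E 0 0 - E 1 1 + 2 * B 0 1), E 1 2 - B 0 2;
        -E 2 2, E 0 2 + B 1 2, E 1 2 - B 0 2, E 2 2] := by
  have e1 := hE.apply 0 1
  have e2 := hE.apply 0 2
  have e3 := hE.apply 1 2
  have b1 := hB.apply 0 1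
  have b2 := hB.apply 0 2
  have b3 := hB.apply 1 2
  ext a c
  fin_cases a <;> fin_cases c <;>
    simp [contractVec, ofEB, rform, Fin.sum_univ_succ, e1, e2, e3, b1, b2, b3] <;> ring

theorem contractVec_null_eq_zero_iff {E B : Matrix (Fin 3) (Fin 3) ℝ} (hE : E.IsSymm)
    (hB : B.IsSymm) :
    contractVec (ofEB E B) ![1, 0, 0, 1] = 0 ↔ IsDebeverEB E B ∧ E 2 2 = 0 := by
  rw [contractVec_ofEB_null hE hB]
  constructor
  · intro h
    have h' := fun a b => congrFun (congrFun h a) b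
    have h00 := h' 0 0
    have h31 := h' 3 1
    have h32 := h' 3 2
    have h11 := h' 1 1
    have h12 := h' 1 2
    simp at h00 h31 h32 h11 h12
    exact ⟨⟨h31, h32, h11, h12⟩, h00⟩
  · rintro ⟨⟨h1, h2, h3, h4⟩, h5⟩
    rw [h1, h2, h3, h4, h5]
    ext a c
    fin_cases a <;> fin_cases c <;> simp

/-- The entry `E 2 2` multiplies l ⊗ l with l lowered to (-1, 0, 0, 1), so it is no obstruction to a
factor l; the other four combinations are. -/
theorem contractVec_null_eq_vecMulVec_iff {E B : Matrix (Fin 3) (Fin 3) ℝ} (hE : E.IsSymm)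
    (hB : B.IsSymm) :
    (∃ k, contractVec (ofEB E B) ![1, 0, 0, 1] = vecMulVec k ![-1, 0, 0, 1]) ↔
      IsDebeverEB E B := by
  rw [contractVec_ofEB_null hE hB]
  constructor
  · rintro ⟨k, h⟩
    have h' := fun a b => congrFun (congrFun h a) b
    have h31 := h' 3 1
    have h32 := h' 3 2
    have h11 := h' 1 1
    have h12 := h' 1 2
    simp [vecMulVec_apply] at h31 h32 h11 h12
    exact ⟨h31, h32, h11, h12⟩
  · rintro ⟨h1, h2, h3, h4⟩
    refine ⟨![-E 2 2, 0, 0, E 2 2], ?_⟩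
    rw [h1, h2, h3, h4]
    ext a c
    fin_cases a <;> fin_cases c <;> simp [vecMulVec_apply]

/-- The vector (1, i, 0) is the electric part of the bivector l ∧ (e₁ + i e₂), with l = e₀ + e₃.
Eliminating the eigenvalue leaves two complex equations, whose real and imaginary parts are the four
Debever equations. -/
theorem isDebeverEB_iff {E B : Matrix (Fin 3) (Fin 3) ℝ} (hE : E.IsSymm) (hB : B.IsSymm) :
    IsDebeverEB E B ↔ ∃ μ : ℂ, qMat E B *ᵥ ![1, Complex.I, 0] = μ • ![1, Complex.I, 0] := by
  have e1 := hE.apply 0 1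
  have e2 := hE.apply 0 2
  have e3 := hE.apply 1 2
  have b1 := hB.apply 0 1
  have b2 := hB.apply 0 2
  have b3 := hB.apply 1 2
  constructor
  · rintro ⟨h1, h2, h3, h4⟩
    refine ⟨qMat E B 0 0 + Complex.I * qMat E B 0 1, ?_⟩
    funext i
    fin_cases i <;> apply Complex.ext <;>
      simp [mulVec, dotProduct, Fin.sum_univ_succ, qMat, e1, e2, e3, b1, b2, b3] <;> linarith
  · rintro ⟨μ, h⟩
    have r0 := congrArg Complex.re (congrFun h 0)
    have r1 := congrArg Complex.re (congrFun h 1)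
    have r2 := congrArg Complex.re (congrFun h 2)
    have i0 := congrArg Complex.im (congrFun h 0)
    have i1 := congrArg Complex.im (congrFun h 1)
    have i2 := congrArg Complex.im (congrFun h 2)
    simp [mulVec, dotProduct, Fin.sum_univ_succ, qMat, e1, e2, e3, b1, b2, b3] at r0 r1 r2 i0 i1 i2
    refine ⟨?_, ?_, ?_, ?_⟩ <;> linarith

/-- A trace-free quadratic form on the plane vanishes on some unit vector: choose the angle t so
that (cos 2t, sin 2t) is orthogonal to (k, l). -/
theorem exists_sq_add_sq_eq_one (k l : ℝ) :
    ∃ c s : ℝ, c ^ 2 + s ^ 2 = 1 ∧ k * (c ^ 2 - s ^ 2) + l * (2 * c * s) = 0 := by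
  set z : ℂ := ⟨k, -l⟩ with hz
  refine ⟨Real.cos (-(z.arg - Real.pi / 2) / 2), Real.sin (-(z.arg - Real.pi / 2) / 2),
    Real.cos_sq_add_sin_sq _, ?_⟩
  set t := -(z.arg - Real.pi / 2) / 2 with ht
  have h1 : Real.cos t ^ 2 - Real.sin t ^ 2 = Real.sin z.arg := by
    rw [← Real.cos_two_mul', ht, ← Real.cos_pi_div_two_sub]
    congr 1
    ring
  have h2 : 2 * Real.cos t * Real.sin t = Real.cos z.arg := by
    rw [mul_right_comm, ← Real.sin_two_mul, ht, ← Real.sin_pi_div_two_sub]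
    congr 1
    ring
  rw [h1, h2]
  have hk : k = ‖z‖ * Real.cos z.arg := by rw [Complex.norm_mul_cos_arg]
  have hl : -l = ‖z‖ * Real.sin z.arg := by rw [Complex.norm_mul_sin_arg]
  rw [hk, show l = -(‖z‖ * Real.sin z.arg) by linarith]
  ring

set_option maxHeartbeats 1000000 in
/-- The contraction with a unit vector orthogonal to the multiple Debever vector `e₀ + e₃`. -/
theorem contractVec_ofEB_orthogonal {E B : Matrix (Fin 3) (Fin 3) ℝ} (hE : E.IsSymm)
    (hB : B.IsSymm) (hE0 : E.trace = 0) (hB0 : B.trace = 0) (hD : IsDebeverEB E B)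
    (h22 : E 2 2 = 0) (c s α X Y : ℝ)
    (hX : X = 2 * α * (c * E 0 2 + s * E 1 2) + E 0 0 * (c ^ 2 - s ^ 2) + E 0 1 * (2 * c * s))
    (hY : Y = 3 / 2 * α * B 2 2 + c * E 1 2 - s * E 0 2) :
    contractVec (ofEB E B) ![α, c, s, α] =
      !![X, s * Y, -(c * Y), -X; s * Y, 0, 0, -(s * Y); -(c * Y), 0, 0, c * Y;
        -X, -(s * Y), c * Y, X] := by
  have e1 := hE.apply 0 1
  have e2 := hE.apply 0 2
  have e3 := hE.apply 1 2
  have b1 := hB.apply 0 1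
  have b2 := hB.apply 0 2
  have b3 := hB.apply 1 2
  obtain ⟨h1, h2, h3, h4⟩ := hD
  simp only [Matrix.trace, Fin.sum_univ_three, diag_apply] at hE0 hB0
  -- The Debever and trace equations leave only E₀₀, E₀₁, E₀₂, E₁₂ and B₂₂ free.
  have hb12 : B 1 2 = -E 0 2 := by linarith
  have hb02 : B 0 2 = E 1 2 := by linarith
  have he11 : E 1 1 = -E 0 0 := by linarith
  have hb01 : B 0 1 = -E 0 0 := by linarith
  have hb00 : B 0 0 = E 0 1 - B 2 2 / 2 := by linarith
  have hb11 : B 1 1 = -E 0 1 - B 2 2 / 2 := by linarith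
  rw [hX, hY]
  clear h1 h2 h3 h4 hE0 hB0 hX hY hE hB
  ext a k
  fin_cases a <;> fin_cases k <;>
    simp [contractVec, ofEB, rform, Fin.sum_univ_succ, e1, e2, e3, b1, b2, b3, hb12, hb02, he11,
      hb01, hb00, hb11, h22] <;> ring

/-- If `W(l;l) = 0` for the null vector `l = e₀ + e₃`, then `W(w;w) = 0` for some unit vector `w`
orthogonal to `l`. -/
theorem exists_spacelike_of_null {E B : Matrix (Fin 3) (Fin 3) ℝ} (hE : E.IsSymm)
    (hB : B.IsSymm) (hE0 : E.trace = 0) (hB0 : B.trace = 0) (hD : IsDebeverEB E B)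
    (h22 : E 2 2 = 0) : ∃ c s α : ℝ, c ^ 2 + s ^ 2 = 1 ∧
      contractVec (ofEB E B) ![α, c, s, α] = 0 := by
  have key : ∀ c s α : ℝ, 2 * α * (c * E 0 2 + s * E 1 2) + E 0 0 * (c ^ 2 - s ^ 2)
      + E 0 1 * (2 * c * s) = 0 → 3 / 2 * α * B 2 2 + c * E 1 2 - s * E 0 2 = 0 →
      contractVec (ofEB E B) ![α, c, s, α] = 0 := by
    intro c s α hX hY
    rw [contractVec_ofEB_orthogonal hE hB hE0 hB0 hD h22 c s α 0 0 hX.symm hY.symm]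
    ext a k
    fin_cases a <;> fin_cases k <;> simp
  by_cases hb : B 2 2 = 0
  · by_cases hr : E 0 2 ^ 2 + E 1 2 ^ 2 = 0
    · have h02 : E 0 2 = 0 := by nlinarith [sq_nonneg (E 0 2), sq_nonneg (E 1 2)]
      have h12 : E 1 2 = 0 := by nlinarith [sq_nonneg (E 0 2), sq_nonneg (E 1 2)]
      -- The second equation is now void and the first is a trace-free form in (c, s).
      obtain ⟨c, s, hcs, h⟩ := exists_sq_add_sq_eq_one (E 0 0) (E 0 1)
      refine ⟨c, s, 0, hcs, key c s 0 ?_ ?_⟩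
      · linear_combination h
      · rw [h02, h12]
        ring
    · have hpos : 0 < E 0 2 ^ 2 + E 1 2 ^ 2 := lt_of_le_of_ne (by positivity) (Ne.symm hr)
      obtain ⟨r, hr0, hr2⟩ : ∃ r : ℝ, r ≠ 0 ∧ r ^ 2 = E 0 2 ^ 2 + E 1 2 ^ 2 :=
        ⟨√_, (Real.sqrt_pos.2 hpos).ne', Real.sq_sqrt hpos.le⟩
      have hcs : (E 0 2 / r) ^ 2 + (E 1 2 / r) ^ 2 = 1 := by
        field_simp
        rw [hr2]
      -- Taking (c, s) parallel to (E₀₂, E₁₂) satisfies the second equation; the first is then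
      -- linear in α with slope 2r.
      refine ⟨E 0 2 / r, E 1 2 / r, -(E 0 0 * ((E 0 2 / r) ^ 2 - (E 1 2 / r) ^ 2)
        + E 0 1 * (2 * (E 0 2 / r) * (E 1 2 / r))) / (2 * r), hcs, key _ _ _ ?_ ?_⟩
      · have : E 0 2 / r * E 0 2 + E 1 2 / r * E 1 2 = r := by
          field_simp
          rw [hr2]
        rw [this]
        generalize E 0 0 * ((E 0 2 / r) ^ 2 - (E 1 2 / r) ^ 2) = u
        generalize E 0 1 * (2 * (E 0 2 / r) * (E 1 2 / r)) = w
        field_simp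
        ring
      · rw [hb]
        ring
  -- The second equation determines α. Substituted into the first, it again gives a trace-free
  -- quadratic form in (c, s), with these coefficients.
  · obtain ⟨c, s, hcs, h⟩ := exists_sq_add_sq_eq_one (E 0 0 - 4 / (3 * B 2 2) * (E 0 2 * E 1 2))
      (E 0 1 + 2 / (3 * B 2 2) * (E 0 2 ^ 2 - E 1 2 ^ 2))
    refine ⟨c, s, 2 / (3 * B 2 2) * (s * E 0 2 - c * E 1 2), hcs, key _ _ _ ?_ ?_⟩
    · linear_combination h
    · field_simp
      ring

/-! ### Eigenvectors of complex symmetric matrices -/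

/-- The orthogonal complement of two eigenvectors of a symmetric Q is invariant, and nonzero in ℂ³,
so it contains an eigenvector. The given vectors may be zero or equal, which allows iteration from
nothing. -/
theorem exists_eigenvector_orthogonal {Q : Matrix (Fin 3) (Fin 3) ℂ} (hQ : Q.IsSymm)
    {v w : Fin 3 → ℂ} {ρ σ : ℂ} (hv : Q *ᵥ v = ρ • v) (hw : Q *ᵥ w = σ • w) :
    ∃ f : Fin 3 → ℂ, f ≠ 0 ∧ v ⬝ᵥ f = 0 ∧ w ⬝ᵥ f = 0 ∧ ∃ μ : ℂ, Q *ᵥ f = μ • f := by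
  have hinv : ∀ {u : Fin 3 → ℂ} {τ : ℂ}, Q *ᵥ u = τ • u → ∀ x, u ⬝ᵥ Q *ᵥ x = τ * (u ⬝ᵥ x) := by
    intro u τ hu x
    rw [dotProduct_mulVec, ← mulVec_transpose, hQ.eq, hu, smul_dotProduct, smul_eq_mul]
  let K : Submodule ℂ (Fin 3 → ℂ) := LinearMap.ker (Matrix.toLin' (Matrix.of ![v, w, w]))
  have hK : ∀ x, x ∈ K ↔ v ⬝ᵥ x = 0 ∧ w ⬝ᵥ x = 0 := by
    intro x
    simp only [K, LinearMap.mem_ker, toLin'_apply]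
    constructor
    · intro h
      exact ⟨congrFun h 0, congrFun h 1⟩
    · rintro ⟨h1, h2⟩
      funext i
      fin_cases i
      exacts [h1, h2, h2]
  -- The repeated third row makes the square matrix singular.
  obtain ⟨x, hx0, hx⟩ : ∃ x, x ≠ 0 ∧ (Matrix.of ![v, w, w]) *ᵥ x = 0 :=
    Matrix.exists_mulVec_eq_zero_iff.2
      (Matrix.det_zero_of_row_eq (i := 1) (j := 2) (by decide) rfl)
  have hxK : x ∈ K := by simpa [K] using hx
  have hmap : ∀ y ∈ K, Matrix.toLin' Q y ∈ K := by
    intro y hy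
    obtain ⟨h1, h2⟩ := (hK y).1 hy
    rw [hK, toLin'_apply, hinv hv, hinv hw, h1, h2]
    simp
  have : Nontrivial K := ⟨⟨⟨x, hxK⟩, 0, fun h => hx0 (congrArg Subtype.val h)⟩⟩
  obtain ⟨μ, hμ⟩ := Module.End.exists_eigenvalue ((Matrix.toLin' Q).restrict hmap)
  obtain ⟨f, hf⟩ := hμ.exists_hasEigenvector
  refine ⟨f, fun h => hf.2 (Subtype.ext h), ((hK f).1 f.2).1, ((hK f).1 f.2).2, μ, ?_⟩
  exact congrArg Subtype.val hf.apply_eq_smul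

theorem dotProduct_eq_zero_of_eigenvector {Q : Matrix (Fin 3) (Fin 3) ℂ} (hQ : Q.IsSymm)
    {v w : Fin 3 → ℂ} {ρ σ : ℂ} (hv : Q *ᵥ v = ρ • v) (hw : Q *ᵥ w = σ • w) (h : ρ ≠ σ) :
    v ⬝ᵥ w = 0 := by
  have h1 : v ⬝ᵥ Q *ᵥ w = ρ * (v ⬝ᵥ w) := by
    rw [dotProduct_mulVec, ← mulVec_transpose, hQ.eq, hv, smul_dotProduct, smul_eq_mul]
  rw [hw, dotProduct_smul, smul_eq_mul] at h1
  have h2 : (ρ - σ) * (v ⬝ᵥ w) = 0 := by linear_combination -h1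
  exact (mul_eq_zero.1 h2).resolve_left (sub_ne_zero.2 h)

/-- Inside an eigenspace of dimension at least two, v + t w is isotropic for t² = -(v·v)/(w·w). -/
theorem exists_isotropic_of_eq {Q : Matrix (Fin 3) (Fin 3) ℂ} {v w : Fin 3 → ℂ} {ρ : ℂ}
    (hv : Q *ᵥ v = ρ • v) (hw : Q *ᵥ w = ρ • w) (hvw : v ⬝ᵥ w = 0) (hv0 : v ⬝ᵥ v ≠ 0)
    (hw0 : w ⬝ᵥ w ≠ 0) : ∃ f : Fin 3 → ℂ, f ≠ 0 ∧ f ⬝ᵥ f = 0 ∧ ∃ μ : ℂ, Q *ᵥ f = μ • f := by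
  obtain ⟨t, ht⟩ := IsAlgClosed.exists_pow_nat_eq (-(v ⬝ᵥ v) / (w ⬝ᵥ w)) (n := 2) (by norm_num)
  have hwv : w ⬝ᵥ v = 0 := by rw [dotProduct_comm, hvw]
  refine ⟨v + t • w, fun h => hv0 ?_, ?_, ρ, ?_⟩
  · have := congrArg (v ⬝ᵥ ·) h
    simpa [dotProduct_add, hvw] using this
  · simp only [add_dotProduct, dotProduct_add, smul_dotProduct, dotProduct_smul, smul_eq_mul, hvw,
      hwv]
    have : t ^ 2 * (w ⬝ᵥ w) = -(v ⬝ᵥ v) := by rw [ht, div_mul_cancel₀ _ hw0]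
    linear_combination this
  · rw [mulVec_add, mulVec_smul, hv, hw, smul_add, smul_comm]

/-- A complex symmetric matrix of order three has an isotropic eigenvector if and only if it does
not have three different eigenvalues. -/
theorem exists_isotropic_eigenvector_iff {Q : Matrix (Fin 3) (Fin 3) ℂ} (hQ : Q.IsSymm) :
    (∃ f : Fin 3 → ℂ, f ≠ 0 ∧ f ⬝ᵥ f = 0 ∧ ∃ μ : ℂ, Q *ᵥ f = μ • f) ↔
      ¬∃ ρ : Fin 3 → ℂ, Function.Injective ρ ∧ ∀ i, ∃ f, f ≠ 0 ∧ Q *ᵥ f = ρ i • f := by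
  constructor
  · rintro ⟨f, hf0, hff, μ, hf⟩ ⟨ρ, hρ, hv⟩
    choose v hv0 hv using hv
    have hvv : ∀ i j, i ≠ j → v i ⬝ᵥ v j = 0 := fun i j hij =>
      dotProduct_eq_zero_of_eigenvector hQ (hv i) (hv j) (hρ.ne hij)
    have hli : LinearIndependent ℂ v :=
      Module.End.eigenvectors_linearIndependent' (Matrix.toLin' Q) ρ hρ v fun i =>
        Module.End.hasEigenvector_iff.2 ⟨Module.End.mem_eigenspace_iff.2 (hv i), hv0 i⟩
    have hu : IsUnit (Matrix.of v) := Matrix.linearIndependent_rows_iff_isUnit.1 hli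
    have hzero : ∀ x, (∀ i, v i ⬝ᵥ x = 0) → x = 0 := by
      intro x hx
      have h : Matrix.of v *ᵥ x = 0 := funext hx
      exact Matrix.mulVec_injective_of_isUnit hu (h.trans (mulVec_zero _).symm)
    -- A self-orthogonal `v i` would be orthogonal to a whole basis, hence zero.
    have hne : ∀ i, v i ⬝ᵥ v i ≠ 0 := by
      intro i h
      refine hv0 i (hzero _ fun j => ?_)
      by_cases hij : j = i
      · rw [hij, h]
      · exact hvv j i hij
    -- Either f is a multiple of one non-isotropic `v i`, or it is orthogonal to all of them.
    by_cases h : ∃ i, ρ i = μ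
    · obtain ⟨i, rfl⟩ := h
      have hf' : f - ((v i ⬝ᵥ f) / (v i ⬝ᵥ v i)) • v i = 0 := by
        refine hzero _ fun j => ?_
        rw [dotProduct_sub, dotProduct_smul, smul_eq_mul]
        by_cases hij : j = i
        · rw [hij, div_mul_cancel₀ _ (hne i), sub_self]
        · rw [hvv j i hij, dotProduct_eq_zero_of_eigenvector hQ (hv j) hf (hρ.ne hij)]
          simp
      rw [sub_eq_zero] at hf'
      rw [hf', smul_dotProduct, dotProduct_smul, smul_eq_mul, smul_eq_mul] at hff
      rcases mul_eq_zero.1 hff with h | h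
      · exact hf0 (by rw [hf', h, zero_smul])
      · rcases mul_eq_zero.1 h with h | h
        · exact hf0 (by rw [hf', h, zero_smul])
        · exact hne i h
    · push Not at h
      exact hf0 (hzero f fun i => dotProduct_eq_zero_of_eigenvector hQ (hv i) hf (h i))
  · intro hcon
    by_contra hiso
    have hiso' : ∀ {f : Fin 3 → ℂ} {μ : ℂ}, f ≠ 0 → Q *ᵥ f = μ • f → f ⬝ᵥ f ≠ 0 :=
      fun h0 h1 h => hiso ⟨_, h0, h, _, h1⟩
    -- The zero vector imposes no condition, which starts the orthogonal construction.
    have hz : Q *ᵥ 0 = (0 : ℂ) • (0 : Fin 3 → ℂ) := by simp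
    obtain ⟨a, ha0, -, -, α, ha⟩ := exists_eigenvector_orthogonal hQ hz hz
    obtain ⟨b, hb0, hab, -, β, hb⟩ := exists_eigenvector_orthogonal hQ ha ha
    obtain ⟨c, hc0, hac, hbc, γ, hc⟩ := exists_eigenvector_orthogonal hQ ha hb
    have hne : ∀ {v w : Fin 3 → ℂ} {ρ σ : ℂ}, Q *ᵥ v = ρ • v → Q *ᵥ w = σ • w → v ≠ 0 → w ≠ 0 →
        v ⬝ᵥ w = 0 → ρ ≠ σ := by
      rintro v w ρ σ hv hw hv0 hw0 hvw rfl
      exact hiso (exists_isotropic_of_eq hv hw hvw (hiso' hv0 hv) (hiso' hw0 hw))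
    refine hcon ⟨![α, β, γ], ?_, ?_⟩
    · have h1 := hne ha hb ha0 hb0 hab
      have h2 := hne ha hc ha0 hc0 hac
      have h3 := hne hb hc hb0 hc0 hbc
      intro i j hij
      fin_cases i <;> fin_cases j <;> simp_all
    · intro i
      fin_cases i
      exacts [⟨a, ha0, ha⟩, ⟨b, hb0, hb⟩, ⟨c, hc0, hc⟩]

/-! ### Lorentz transformations -/

/-- The Lorentz transformation given by a rotation of space. -/
def rot (R : Matrix (Fin 3) (Fin 3) ℝ) : Matrix (Fin 4) (Fin 4) ℝ :=
  !![1, 0, 0, 0; 0, R 0 0, R 0 1, R 0 2; 0, R 1 0, R 1 1, R 1 2; 0, R 2 0, R 2 1, R 2 2]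

theorem isFrame_rot {R : Matrix (Fin 3) (Fin 3) ℝ} (h : Rᵀ * R = 1) (hd : 0 < R.det) :
    IsFrame minkowski (rot R) := by
  have h' : ∀ i j, (Rᵀ * R) i j = (1 : Matrix (Fin 3) (Fin 3) ℝ) i j := fun i j => by rw [h]
  have h00 := h' 0 0
  have h01 := h' 0 1
  have h02 := h' 0 2
  have h11 := h' 1 1
  have h12 := h' 1 2
  have h22 := h' 2 2
  simp [Matrix.mul_apply, Fin.sum_univ_succ] at h00 h01 h02 h11 h12 h22
  refine ⟨?_, ?_⟩
  · ext i j
    fin_cases i <;> fin_cases j <;>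
      simp [rot, minkowski, Matrix.mul_apply, Fin.sum_univ_succ, diagonal_apply] <;> linarith
  · rw [det_fin_three] at hd
    simp only [rot, det_four, of_apply, cons_val]
    linarith

/-- The matrix with columns `x`, `y` and `x × y`. -/
def crossMat (x y : Fin 3 → ℝ) : Matrix (Fin 3) (Fin 3) ℝ :=
  !![x 0, y 0, x 1 * y 2 - x 2 * y 1; x 1, y 1, x 2 * y 0 - x 0 * y 2;
    x 2, y 2, x 0 * y 1 - x 1 * y 0]

theorem isFrame_rot_crossMat {x y : Fin 3 → ℝ} (hx : x ⬝ᵥ x = 1) (hy : y ⬝ᵥ y = 1)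
    (hxy : x ⬝ᵥ y = 0) : IsFrame minkowski (rot (crossMat x y)) := by
  simp only [dotProduct, Fin.sum_univ_three] at hx hy hxy
  -- Lagrange's identity for |x × y|².
  have hc : (x 1 * y 2 - x 2 * y 1) ^ 2 + (x 2 * y 0 - x 0 * y 2) ^ 2
      + (x 0 * y 1 - x 1 * y 0) ^ 2 = 1 := by
    linear_combination (y 0 * y 0 + y 1 * y 1 + y 2 * y 2) * hx + hy
      - (x 0 * y 0 + x 1 * y 1 + x 2 * y 2) * hxy
  refine isFrame_rot ?_ ?_
  · ext i j
    fin_cases i <;> fin_cases j <;>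
      simp [crossMat, Matrix.mul_apply, Fin.sum_univ_succ] <;> linarith
  · rw [det_fin_three]
    simp only [crossMat, of_apply, cons_val]
    linarith

/-- Take any unit x orthogonal to n and y = n × x. The first coordinate axis serves as x when n lies
along the third axis. -/
theorem exists_orthonormal_cross {n : Fin 3 → ℝ} (hn : n ⬝ᵥ n = 1) : ∃ x y : Fin 3 → ℝ,
    x ⬝ᵥ x = 1 ∧ y ⬝ᵥ y = 1 ∧ x ⬝ᵥ y = 0 ∧ x 1 * y 2 - x 2 * y 1 = n 0 ∧
      x 2 * y 0 - x 0 * y 2 = n 1 ∧ x 0 * y 1 - x 1 * y 0 = n 2 := by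
  simp only [dotProduct, Fin.sum_univ_three] at hn ⊢
  obtain ⟨a, b, c, hx, hxn⟩ : ∃ a b c : ℝ, a * a + b * b + c * c = 1 ∧
      a * n 0 + b * n 1 + c * n 2 = 0 := by
    by_cases h : n 0 * n 0 + n 1 * n 1 = 0
    · have h0 : n 0 = 0 := by nlinarith [mul_self_nonneg (n 0), mul_self_nonneg (n 1)]
      have h1 : n 1 = 0 := by nlinarith [mul_self_nonneg (n 0), mul_self_nonneg (n 1)]
      exact ⟨1, 0, 0, by norm_num, by rw [h0, h1]; ring⟩
    · have hpos : 0 < n 0 * n 0 + n 1 * n 1 :=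
        lt_of_le_of_ne (add_nonneg (mul_self_nonneg _) (mul_self_nonneg _)) (Ne.symm h)
      obtain ⟨r, hr0, hr2⟩ : ∃ r : ℝ, r ≠ 0 ∧ r ^ 2 = n 0 * n 0 + n 1 * n 1 :=
        ⟨√_, (Real.sqrt_pos.2 hpos).ne', Real.sq_sqrt hpos.le⟩
      refine ⟨-n 1 / r, n 0 / r, 0, ?_, ?_⟩
      · field_simp
        linarith
      · field_simp
        ring
  refine ⟨![a, b, c], ![n 1 * c - n 2 * b, n 2 * a - n 0 * c, n 0 * b - n 1 * a], ?_, ?_, ?_, ?_,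
    ?_, ?_⟩ <;> simp only [cons_val]
  · exact hx
  · linear_combination (n 0 * n 0 + n 1 * n 1 + n 2 * n 2) * hx + hn
      - (a * n 0 + b * n 1 + c * n 2) * hxn
  · ring
  · linear_combination n 0 * hx - a * hxn
  · linear_combination n 1 * hx - b * hxn
  · linear_combination n 2 * hx - c * hxn

theorem dotProduct_minkowski (v w : Fin 4 → ℝ) :
    v ⬝ᵥ minkowski *ᵥ w = -(v 0 * w 0) + v 1 * w 1 + v 2 * w 2 + v 3 * w 3 := by
  simp [minkowski, mulVec, dotProduct, diagonal_apply, Fin.sum_univ_succ]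
  ring

/-- The spatial part divided by the nonzero time component is a unit vector; rotate e₃ onto it. -/
theorem exists_frame_of_null {v : Fin 4 → ℝ} (hv0 : v ≠ 0) (hv : v ⬝ᵥ minkowski *ᵥ v = 0) :
    ∃ L, IsFrame minkowski L ∧ ∃ r : ℝ, r ≠ 0 ∧ v = L *ᵥ (r • ![1, 0, 0, 1]) := by
  rw [dotProduct_minkowski] at hv
  have ht : v 0 ≠ 0 := by
    intro h0
    rw [h0] at hv
    apply hv0
    funext i
    fin_cases i
    · exact h0
    all_goals
      simp only [Fin.mk_one, Fin.reduceFinMk, Pi.zero_apply]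
      nlinarith [mul_self_nonneg (v 1), mul_self_nonneg (v 2), mul_self_nonneg (v 3)]
  obtain ⟨x, y, hx, hy, hxy, h0, h1, h2⟩ :=
    exists_orthonormal_cross (n := ![v 1 / v 0, v 2 / v 0, v 3 / v 0]) (by
      simp only [dotProduct, Fin.sum_univ_three, cons_val]
      field_simp
      linarith)
  refine ⟨_, isFrame_rot_crossMat hx hy hxy, v 0, ht, ?_⟩
  simp only [cons_val] at h0 h1 h2
  funext i
  fin_cases i <;> simp [rot, crossMat, mulVec, dotProduct, Fin.sum_univ_succ, h0, h1, h2] <;>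
    field_simp

/-- The matrix is the symmetric boost taking e₀ to the unit vector (t, n), with spatial block 1 + n
nᵀ/(1 + t). -/
theorem exists_frame_of_timelike {v : Fin 4 → ℝ} (hv : v ⬝ᵥ minkowski *ᵥ v < 0) :
    ∃ L, IsFrame minkowski L ∧ ∃ r : ℝ, r ≠ 0 ∧ v = L *ᵥ (r • ![1, 0, 0, 0]) := by
  rw [dotProduct_minkowski] at hv
  -- The sign of r follows that of `v 0`, so that t ≥ 0 and 1 + t is invertible.
  obtain ⟨r, hr0, hr2, hr⟩ : ∃ r : ℝ, r ≠ 0 ∧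
      r ^ 2 = v 0 * v 0 - v 1 * v 1 - v 2 * v 2 - v 3 * v 3 ∧ 0 ≤ v 0 / r := by
    have hpos : 0 < v 0 * v 0 - v 1 * v 1 - v 2 * v 2 - v 3 * v 3 := by linarith
    have hs := Real.sqrt_pos.2 hpos
    rcases le_total 0 (v 0) with h | h
    · exact ⟨_, hs.ne', Real.sq_sqrt hpos.le, div_nonneg h hs.le⟩
    · exact ⟨-√_, (neg_neg_of_pos hs).ne, by rw [neg_sq, Real.sq_sqrt hpos.le],
        div_nonneg_of_nonpos h (neg_nonpos.2 hs.le)⟩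
  obtain ⟨t, a, b, c, rfl⟩ : ∃ t a b c : ℝ, v = ![r * t, r * a, r * b, r * c] := by
    refine ⟨v 0 / r, v 1 / r, v 2 / r, v 3 / r, ?_⟩
    funext i
    fin_cases i <;> simp <;> field_simp
  simp only [cons_val] at hr2 hr
  rw [mul_div_cancel_left₀ _ hr0] at hr
  have hn : t * t = 1 + a * a + b * b + c * c := by
    have : r ^ 2 * (t * t - 1 - a * a - b * b - c * c) = 0 := by linear_combination -hr2
    have := (mul_eq_zero.1 this).resolve_left (pow_ne_zero 2 hr0)
    linarith
  obtain ⟨k, hk⟩ : ∃ k : ℝ, k * (1 + t) = 1 := ⟨(1 + t)⁻¹, inv_mul_cancel₀ (by linarith)⟩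
  have hk1 : k * (a * a + b * b + c * c) = t - 1 := by
    linear_combination -k * hn + (t - 1) * hk
  have hk2 : 2 * k + k ^ 2 * (a * a + b * b + c * c) = 1 := by
    linear_combination k * hk1 + hk
  refine ⟨!![t, a, b, c; a, 1 + k * a * a, k * a * b, k * a * c;
    b, k * b * a, 1 + k * b * b, k * b * c; c, k * c * a, k * c * b, 1 + k * c * c], ⟨?_, ?_⟩,
    r, hr0, ?_⟩
  · ext i j
    fin_cases i <;> fin_cases j <;>
      simp [minkowski, Matrix.mul_apply, Fin.sum_univ_succ, diagonal_apply]
    · linear_combination -hn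
    · linear_combination a * hk1
    · linear_combination b * hk1
    · linear_combination c * hk1
    · linear_combination a * hk1
    · linear_combination a * a * hk2
    · linear_combination a * b * hk2
    · linear_combination a * c * hk2
    · linear_combination b * hk1
    · linear_combination a * b * hk2
    · linear_combination b * b * hk2
    · linear_combination b * c * hk2
    · linear_combination c * hk1
    · linear_combination a * c * hk2
    · linear_combination b * c * hk2
    · linear_combination c * c * hk2
  · rw [det_four]
    simp only [of_apply, cons_val]
    have : t * (1 + k * (a * a + b * b + c * c)) - (a * a + b * b + c * c) = 1 := by
      linear_combination t * hk1 + hn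
    linarith
  · funext i
    fin_cases i <;> simp [mulVec, dotProduct, Fin.sum_univ_succ, mul_comm]

theorem exists_diagonalization {H : Matrix (Fin 3) (Fin 3) ℝ} (hH : H.IsSymm) :
    ∃ R : Matrix (Fin 3) (Fin 3) ℝ, Rᵀ * R = 1 ∧ 0 < R.det ∧ ∃ d, Rᵀ * H * R = diagonal d := by
  have hH' : H.IsHermitian := by rw [IsHermitian, conjTranspose_eq_transpose_of_trivial, hH.eq]
  obtain ⟨U, hU1, d, hUd⟩ : ∃ U : Matrix (Fin 3) (Fin 3) ℝ, Uᵀ * U = 1 ∧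
      ∃ d, Uᵀ * H * U = diagonal d := by
    refine ⟨hH'.eigenvectorUnitary, ?_, RCLike.ofReal ∘ hH'.eigenvalues, ?_⟩
    · rw [← conjTranspose_eq_transpose_of_trivial, ← star_eq_conjTranspose]
      exact Unitary.coe_star_mul_self _
    · rw [← conjTranspose_eq_transpose_of_trivial, ← star_eq_conjTranspose]
      have := hH'.conjStarAlgAut_star_eigenvectorUnitary
      rwa [Unitary.conjStarAlgAut_star_apply] at this
  have hdet : U.det ≠ 0 := by
    intro h
    have := congrArg Matrix.det hU1
    rw [det_mul, h, mul_zero, det_one] at this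
    exact zero_ne_one this
  rcases lt_or_gt_of_ne hdet with h | h
  -- In odd dimension -U reverses the orientation and induces the same congruence.
  · refine ⟨-U, ?_, ?_, d, ?_⟩
    · rw [transpose_neg, neg_mul_neg, hU1]
    · rw [det_neg, Fintype.card_fin]
      linarith
    · rw [transpose_neg, Matrix.neg_mul, neg_mul_neg, hUd]
  · exact ⟨U, hU1, h, d, hUd⟩

/-! ### Oriented frames and the duality-rotated Weyl tensor. -/

variable {g P : Matrix (Fin 4) (Fin 4) ℝ} {W : Fin 4 → Fin 4 → Fin 4 → Fin 4 → ℝ}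

/-- Reversing the last vector of the frame corrects the orientation. -/
theorem exists_isFrame (h : Pᵀ * g * P = minkowski) : ∃ P', IsFrame g P' := by
  have hd := det_of_congr h
  have h0 : P.det ≠ 0 := by
    intro h0
    rw [h0] at hd
    norm_num at hd
  rcases lt_or_gt_of_ne h0 with hn | hp
  · refine ⟨P * diagonal ![1, 1, 1, -1], ?_, ?_⟩
    · have : (diagonal ![1, 1, 1, -1] : Matrix (Fin 4) (Fin 4) ℝ) * minkowski
          * diagonal ![1, 1, 1, -1] = minkowski := by
        rw [minkowski, diagonal_mul_diagonal, diagonal_mul_diagonal]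
        congr 1
        funext i
        fin_cases i <;> simp
      rw [transpose_mul, diagonal_transpose, Matrix.mul_assoc, Matrix.mul_assoc, ← Matrix.mul_assoc g,
        ← Matrix.mul_assoc Pᵀ, ← Matrix.mul_assoc Pᵀ, h, ← Matrix.mul_assoc, this]
    · rw [det_mul, det_diagonal, Fin.prod_univ_four]
      simpa using hn
  · exact ⟨P, h, hp⟩

/-- The tensor whose vanishing expresses that `v` is Weyl-aligned with rotation index `σ`. -/
def alignTensor (g : Matrix (Fin 4) (Fin 4) ℝ) (W : Fin 4 → Fin 4 → Fin 4 → Fin 4 → ℝ) (σ : ℝ)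
    (v : Fin 4 → ℝ) : Matrix (Fin 4) (Fin 4) ℝ :=
  Real.cos σ • magnetic g W v + Real.sin σ • electric W v

theorem alignTensor_pull (hP : IsFrame g P) (W : Fin 4 → Fin 4 → Fin 4 → Fin 4 → ℝ) (σ : ℝ)
    (x : Fin 4 → ℝ) :
    alignTensor minkowski (pull P W) σ x = Pᵀ * alignTensor g W σ (P *ᵥ x) * P := by
  rw [alignTensor, alignTensor, magnetic_pull hP, electric, electric, contractVec_pull,
    Matrix.mul_add, Matrix.add_mul, Matrix.mul_smul, Matrix.mul_smul, Matrix.smul_mul,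
    Matrix.smul_mul]

theorem alignTensor_eq_zero_iff (hP : IsFrame g P) (W : Fin 4 → Fin 4 → Fin 4 → Fin 4 → ℝ)
    (σ : ℝ) (x : Fin 4 → ℝ) :
    alignTensor g W σ (P *ᵥ x) = 0 ↔ alignTensor minkowski (pull P W) σ x = 0 := by
  rw [alignTensor_pull hP, hP.congr_eq_zero]

/-- The electric part of the tensor with contractions `alignTensor`. -/
def alignE (E B : Matrix (Fin 3) (Fin 3) ℝ) (σ : ℝ) : Matrix (Fin 3) (Fin 3) ℝ :=
  Real.cos σ • B + Real.sin σ • E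

/-- The magnetic part of the tensor with contractions `alignTensor`. -/
def alignB (E B : Matrix (Fin 3) (Fin 3) ℝ) (σ : ℝ) : Matrix (Fin 3) (Fin 3) ℝ :=
  Real.cos σ • (-E) + Real.sin σ • B

/-- Alignment for W becomes vanishing of a plain contraction for another tensor of Weyl type, whose
Q is multiplied by the unit sin σ + i cos σ. -/
theorem alignTensor_ofEB (E B : Matrix (Fin 3) (Fin 3) ℝ) (σ : ℝ) (x : Fin 4 → ℝ) :
    alignTensor minkowski (ofEB E B) σ x = contractVec (ofEB (alignE E B σ) (alignB E B σ)) x := by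
  ext a c
  simp only [alignTensor, magnetic, electric, dualTensor_ofEB, contractVec, alignE, alignB,
    Matrix.add_apply, Matrix.smul_apply, of_apply, smul_eq_mul, ofEB_add, ofEB_smul,
    Finset.mul_sum, ← Finset.sum_add_distrib]
  refine Finset.sum_congr rfl fun b _ => Finset.sum_congr rfl fun d _ => by ring

theorem contractVec_smul_eq_zero_iff (W : Fin 4 → Fin 4 → Fin 4 → Fin 4 → ℝ) {r : ℝ} (hr : r ≠ 0)
    (v : Fin 4 → ℝ) : contractVec W (r • v) = 0 ↔ contractVec W v = 0 := by
  rw [contractVec_smul, smul_eq_zero, or_iff_right (pow_ne_zero 2 hr)]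

theorem isSymm_alignE {E B : Matrix (Fin 3) (Fin 3) ℝ} (hE : E.IsSymm) (hB : B.IsSymm) (σ : ℝ) :
    (alignE E B σ).IsSymm := (hB.smul _).add (hE.smul _)

theorem isSymm_alignB {E B : Matrix (Fin 3) (Fin 3) ℝ} (hE : E.IsSymm) (hB : B.IsSymm) (σ : ℝ) :
    (alignB E B σ).IsSymm := (hE.neg.smul _).add (hB.smul _)

theorem trace_alignE {E B : Matrix (Fin 3) (Fin 3) ℝ} (hE : E.trace = 0) (hB : B.trace = 0)
    (σ : ℝ) : (alignE E B σ).trace = 0 := by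
  simp [alignE, trace_add, trace_smul, hE, hB]

theorem trace_alignB {E B : Matrix (Fin 3) (Fin 3) ℝ} (hE : E.trace = 0) (hB : B.trace = 0)
    (σ : ℝ) : (alignB E B σ).trace = 0 := by
  simp [alignB, trace_add, trace_smul, hE, hB]

/-- Scaling Q by a unit keeps its eigenvectors. In real terms, the first two equations are rotated
among themselves, and so are the last two. -/
theorem isDebeverEB_align_iff (E B : Matrix (Fin 3) (Fin 3) ℝ) (σ : ℝ) :
    IsDebeverEB (alignE E B σ) (alignB E B σ) ↔ IsDebeverEB E B := by
  have hs := Real.sin_sq_add_cos_sq σ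
  simp only [IsDebeverEB, alignE, alignB, Matrix.add_apply, Matrix.smul_apply, Matrix.neg_apply,
    smul_eq_mul]
  generalize Real.sin σ = s at hs ⊢
  generalize Real.cos σ = c at hs ⊢
  constructor
  · rintro ⟨h1, h2, h3, h4⟩
    refine ⟨?_, ?_, ?_, ?_⟩
    · linear_combination s * h1 + c * h2 - (E 0 2 + B 1 2) * hs
    · linear_combination s * h2 - c * h1 - (E 1 2 - B 0 2) * hs
    · linear_combination s * h3 + c * h4 - (E 0 0 - E 1 1 + 2 * B 0 1) * hs
    · linear_combination s * h4 - c * h3 - (2 * E 0 1 - B 0 0 + B 1 1) * hs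
  · rintro ⟨h1, h2, h3, h4⟩
    refine ⟨?_, ?_, ?_, ?_⟩
    · linear_combination s * h1 + c * (-h2)
    · linear_combination s * h2 + c * h1
    · linear_combination s * h3 - c * h4
    · linear_combination s * h4 + c * h3

/-- Solve tan σ = -b/a by the arctangent, shifted by π when negative; a = 0 takes σ = π/2. -/
theorem exists_rotationIndex (a b : ℝ) :
    ∃ σ : ℝ, 0 ≤ σ ∧ σ < Real.pi ∧ Real.cos σ * b + Real.sin σ * a = 0 := by
  by_cases ha : a = 0
  · refine ⟨Real.pi / 2, by positivity, by linarith [Real.pi_pos], ?_⟩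
    rw [ha, Real.cos_pi_div_two]
    ring
  · obtain ⟨σ, h1, h2⟩ : ∃ σ : ℝ, σ ∈ Set.Ico 0 Real.pi ∧ Real.cos σ * b + Real.sin σ * a = 0 := by
      have hcos := (Real.cos_arctan_pos (-b / a)).ne'
      have hz : Real.cos (Real.arctan (-b / a)) * b + Real.sin (Real.arctan (-b / a)) * a = 0 := by
        have := Real.tan_arctan (-b / a)
        rw [Real.tan_eq_sin_div_cos, div_eq_div_iff hcos ha] at this
        linarith
      have hlt := Real.arctan_lt_pi_div_two (-b / a)
      have hgt := Real.neg_pi_div_two_lt_arctan (-b / a)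
      rcases le_or_gt 0 (Real.arctan (-b / a)) with h | h
      · exact ⟨_, ⟨h, by linarith [Real.pi_pos]⟩, hz⟩
      · refine ⟨Real.arctan (-b / a) + Real.pi, ⟨by linarith, by linarith⟩, ?_⟩
        rw [Real.cos_add_pi, Real.sin_add_pi]
        linarith
    exact ⟨σ, h1.1, h1.2, h2⟩

/-! ### Null vectors -/

/-- The components of a null vector in an adapted frame. -/
theorem alignTensor_null_iff {E B : Matrix (Fin 3) (Fin 3) ℝ} (hE : E.IsSymm) (hB : B.IsSymm)
    {r : ℝ} (hr : r ≠ 0) (σ : ℝ) :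
    alignTensor minkowski (ofEB E B) σ (r • ![1, 0, 0, 1]) = 0 ↔
      IsDebeverEB E B ∧ Real.cos σ * B 2 2 + Real.sin σ * E 2 2 = 0 := by
  rw [alignTensor_ofEB, contractVec_smul_eq_zero_iff _ hr,
    contractVec_null_eq_zero_iff (isSymm_alignE hE hB σ) (isSymm_alignB hE hB σ),
    isDebeverEB_align_iff]
  rfl

/-- The condition `W_{abc[d} l_{e]} l^b l^c = 0`. -/
def DebeverCondition (g : Matrix (Fin 4) (Fin 4) ℝ) (W : Fin 4 → Fin 4 → Fin 4 → Fin 4 → ℝ)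
    (l : Fin 4 → ℝ) : Prop :=
  ∀ a d e : Fin 4, (∑ b, ∑ c, W a b c d * l b * l c) * lower g l e
    - (∑ b, ∑ c, W a b c e * l b * l c) * lower g l d = 0

/-- Antisymmetrising with l says that each row of the contraction is proportional to l; the factor
is found by dividing by a nonzero component. -/
theorem debeverCondition_iff (hW : IsWeylTensor g W) {l : Fin 4 → ℝ} (hl : lower g l ≠ 0) :
    DebeverCondition g W l ↔ ∃ k, contractVec W l = vecMulVec k (lower g l) := by
  have h : ∀ a d, ∑ b, ∑ c, W a b c d * l b * l c = -contractVec W l a d := by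
    intro a d
    simp only [contractVec, of_apply, ← Finset.sum_neg_distrib]
    refine Finset.sum_congr rfl fun b _ => Finset.sum_congr rfl fun c _ => ?_
    rw [hW.antisymm_right a b c d]
    ring
  simp only [DebeverCondition, h]
  constructor
  · intro hD
    obtain ⟨e, he⟩ := Function.ne_iff.1 hl
    rw [Pi.zero_apply] at he
    refine ⟨fun a => contractVec W l a e / lower g l e, ?_⟩
    ext a d
    rw [vecMulVec_apply]
    field_simp
    linarith [hD a d e]
  · rintro ⟨k, hk⟩ a d e
    rw [hk, vecMulVec_apply, vecMulVec_apply]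
    ring

theorem contractVec_eq_vecMulVec_iff (hP : IsFrame g P) (x : Fin 4 → ℝ) :
    (∃ k, contractVec W (P *ᵥ x) = vecMulVec k (lower g (P *ᵥ x))) ↔
      ∃ k, contractVec (pull P W) x = vecMulVec k (lower minkowski x) := by
  rw [contractVec_pull, lower_frame hP]
  constructor
  · rintro ⟨k, hk⟩
    exact ⟨Pᵀ *ᵥ k, by rw [hk, vecMulVec_frame]⟩
  · rintro ⟨k, hk⟩
    have hk' : k = Pᵀ *ᵥ (Pᵀ⁻¹ *ᵥ k) := by
      rw [mulVec_mulVec, mul_nonsing_inv _ (by rw [det_transpose]; exact hP.isUnit_det),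
        one_mulVec]
    rw [hk', vecMulVec_frame, ← sub_eq_zero, ← Matrix.sub_mul, ← Matrix.mul_sub,
      hP.congr_eq_zero, sub_eq_zero] at hk
    exact ⟨_, hk⟩

theorem debeverCondition_frame_iff (hW : IsWeylTensor g W) (hP : IsFrame g P)
    {E B : Matrix (Fin 3) (Fin 3) ℝ} (hE : E.IsSymm) (hB : B.IsSymm) (hEB : pull P W = ofEB E B)
    {r : ℝ} (hr : r ≠ 0) :
    DebeverCondition g W (P *ᵥ (r • ![1, 0, 0, 1])) ↔ IsDebeverEB E B := by
  have hlow : lower minkowski (r • ![1, 0, 0, 1]) = r • ![-1, 0, 0, 1] := by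
    rw [lower_eq]
    funext i
    fin_cases i <;> simp [minkowski, mulVec, dotProduct, diagonal_apply]
  have hl : lower g (P *ᵥ (r • ![1, 0, 0, 1])) ≠ 0 := by
    intro h
    have h' := lower_frame hP (r • ![1, 0, 0, 1])
    rw [h, hlow, mulVec_zero] at h'
    have := congrFun h' 3
    simp [hr] at this
  rw [debeverCondition_iff hW hl, contractVec_eq_vecMulVec_iff hP, hEB, hlow, contractVec_smul,
    ← contractVec_null_eq_vecMulVec_iff hE hB]
  constructor
  · rintro ⟨k, hk⟩
    refine ⟨(r⁻¹) • k, smul_right_injective _ (pow_ne_zero 2 hr) ?_⟩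
    simp only [hk, smul_vecMulVec, vecMulVec_smul, smul_smul]
    congr 1
    field_simp
  · rintro ⟨k, hk⟩
    refine ⟨r • k, ?_⟩
    simp only [hk, smul_vecMulVec, vecMulVec_smul, smul_smul, sq]

/-- A null vector in an adapted frame. -/
theorem exists_adapted_null (hW : IsWeylTensor g W) (hP : IsFrame g P) {l : Fin 4 → ℝ}
    (hl0 : l ≠ 0) (hl : l ⬝ᵥ g *ᵥ l = 0) : ∃ (P' : Matrix (Fin 4) (Fin 4) ℝ) (r : ℝ)
      (E B : Matrix (Fin 3) (Fin 3) ℝ), IsFrame g P' ∧ r ≠ 0 ∧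
      l = P' *ᵥ (r • ![1, 0, 0, 1]) ∧ E.IsSymm ∧ B.IsSymm ∧ E.trace = 0 ∧ B.trace = 0 ∧
      pull P' W = ofEB E B := by
  obtain ⟨x, rfl⟩ := hP.exists_mulVec_eq l
  rw [hP.dotProduct] at hl
  obtain ⟨L, hL, r, hr, rfl⟩ := exists_frame_of_null (fun h => hl0 (by rw [h, mulVec_zero])) hl
  have hPL := hP.mul hL
  obtain ⟨E, B, hE, hB, hE0, hB0, hEB⟩ := (hW.pull hPL).exists_ofEB
  exact ⟨P * L, r, E, B, hPL, hr, mulVec_mulVec _ _ _, hE, hB, hE0, hB0, hEB⟩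

/-- In an adapted frame alignment is the Debever condition plus one scalar equation, which a
suitable σ solves. -/
theorem exists_aligned_iff_debeverCondition (hW : IsWeylTensor g W) (hP : IsFrame g P)
    {l : Fin 4 → ℝ} (hl0 : l ≠ 0) (hl : l ⬝ᵥ g *ᵥ l = 0) :
    (∃ σ, 0 ≤ σ ∧ σ < Real.pi ∧ alignTensor g W σ l = 0) ↔ DebeverCondition g W l := by
  obtain ⟨P', r, E, B, hP', hr, rfl, hE, hB, -, -, hEB⟩ := exists_adapted_null hW hP hl0 hl
  simp only [alignTensor_eq_zero_iff hP', debeverCondition_frame_iff hW hP' hE hB hEB hr, hEB,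
    alignTensor_null_iff hE hB hr]
  constructor
  · rintro ⟨σ, -, -, h, -⟩
    exact h
  · intro h
    obtain ⟨σ, h1, h2, h3⟩ := exists_rotationIndex (E 2 2) (B 2 2)
    exact ⟨σ, h1, h2, h, h3⟩

theorem exists_spacelike_aligned_of_null (hW : IsWeylTensor g W) (hP : IsFrame g P)
    {l : Fin 4 → ℝ} (hl0 : l ≠ 0) (hl : l ⬝ᵥ g *ᵥ l = 0) {σ : ℝ} (h : alignTensor g W σ l = 0) :
    ∃ w, 0 < w ⬝ᵥ g *ᵥ w ∧ alignTensor g W σ w = 0 := by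
  obtain ⟨P', r, E, B, hP', hr, rfl, hE, hB, hE0, hB0, hEB⟩ := exists_adapted_null hW hP hl0 hl
  rw [alignTensor_eq_zero_iff hP', hEB, alignTensor_null_iff hE hB hr] at h
  -- Applied to the rotated tensor, so the vector found has the same index σ.
  obtain ⟨c, s, α, hcs, hw⟩ := exists_spacelike_of_null (isSymm_alignE hE hB σ)
    (isSymm_alignB hE hB σ) (trace_alignE hE0 hB0 σ) (trace_alignB hE0 hB0 σ)
    ((isDebeverEB_align_iff E B σ).2 h.1) h.2
  refine ⟨P' *ᵥ ![α, c, s, α], ?_, ?_⟩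
  · rw [hP'.dotProduct, dotProduct_minkowski]
    simp only [cons_val]
    linarith
  · rw [alignTensor_eq_zero_iff hP', hEB, alignTensor_ofEB, hw]

/-! ### Algebraic types -/

theorem isEigenbivector_ofEB_iff (E B : Matrix (Fin 3) (Fin 3) ℝ) (ρ : ℂ)
    (F : Matrix (Fin 4) (Fin 4) ℂ) : IsEigenbivector minkowski (ofEB E B) ρ F ↔
      ∃ f : Fin 3 → ℂ, f ≠ 0 ∧ qMat E B *ᵥ f = (-ρ) • f ∧ F = rform f (-Complex.I • f) := by
  have hr0 : rform (0 : Fin 3 → ℂ) (-Complex.I • 0) = 0 := by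
    ext a b
    fin_cases a <;> fin_cases b <;> simp [rform]
  have hw : ∀ f : Fin 3 → ℂ, weylMap minkowski (ofEB E B) (rform f (-Complex.I • f))
      = ρ • rform f (-Complex.I • f) ↔ qMat E B *ᵥ f = (-ρ) • f := by
    intro f
    rw [weylMap_ofEB, ← rform_smul, smul_comm ρ (-Complex.I) f]
    constructor
    · intro h
      rw [neg_smul, ← (rform_injective h).1, neg_neg]
    · intro h
      rw [h, neg_smul, neg_neg]
  constructor
  · rintro ⟨h1, h2, h3⟩
    have hF := exists_rform_of_isBivector h1
    refine ⟨_, fun h0 => h2 ?_, ?_, hF⟩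
    · rw [hF, h0, hr0]
    · rw [hF] at h3
      exact (hw _).1 h3
  · rintro ⟨f, hf0, hf, rfl⟩
    refine ⟨isBivector_rform f, fun h => hf0 ?_, (hw f).2 hf⟩
    rw [← hr0] at h
    exact (rform_injective h).1

theorem isSymm_qMat {E B : Matrix (Fin 3) (Fin 3) ℝ} (hE : E.IsSymm) (hB : B.IsSymm) :
    (qMat E B).IsSymm := by
  ext i j
  simp [qMat, hE.apply i j, hB.apply i j]

theorem exists_distinct_eigenbivectors_iff (hP : IsFrame g P) {E B : Matrix (Fin 3) (Fin 3) ℝ}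
    (hEB : pull P W = ofEB E B) :
    (∃ ρ : Fin 3 → ℂ, Function.Injective ρ ∧ ∀ i, ∃ F, IsEigenbivector g W (ρ i) F) ↔
      ∃ ρ : Fin 3 → ℂ, Function.Injective ρ ∧
        ∀ i, ∃ f : Fin 3 → ℂ, f ≠ 0 ∧ qMat E B *ᵥ f = ρ i • f := by
  constructor
  · rintro ⟨ρ, hρ, h⟩
    refine ⟨-ρ, neg_injective.comp hρ, fun i => ?_⟩
    obtain ⟨F, hF⟩ := h i
    rw [← isEigenbivector_pullForm hP, hEB, isEigenbivector_ofEB_iff] at hF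
    obtain ⟨f, h1, h2, -⟩ := hF
    exact ⟨f, h1, h2⟩
  · rintro ⟨ρ, hρ, h⟩
    refine ⟨-ρ, neg_injective.comp hρ, fun i => ?_⟩
    obtain ⟨f, h1, h2⟩ := h i
    obtain ⟨F, hF⟩ := pullForm_surjective hP (rform f (-Complex.I • f))
    refine ⟨F, ?_⟩
    rw [← isEigenbivector_pullForm hP, hEB, isEigenbivector_ofEB_iff, hF]
    exact ⟨f, h1, by rw [Pi.neg_apply, neg_neg, h2], rfl⟩

/-- An isotropic self-dual two-form takes a standard form in a rotated frame. -/
theorem exists_rot_isotropic {f : Fin 3 → ℂ} (hf0 : f ≠ 0) (hf : f ⬝ᵥ f = 0) :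
    ∃ L, IsFrame minkowski L ∧ ∃ r : ℝ, r ≠ 0 ∧ pullForm L (rform f (-Complex.I • f))
      = rform ((r : ℂ) • ![1, Complex.I, 0]) (-Complex.I • (r : ℂ) • ![1, Complex.I, 0]) := by
  set x : Fin 3 → ℝ := fun i => (f i).re with hx
  set y : Fin 3 → ℝ := fun i => (f i).im with hy
  have hre := congrArg Complex.re hf
  have him := congrArg Complex.im hf
  simp only [dotProduct, Fin.sum_univ_three, Complex.add_re, Complex.add_im, Complex.mul_re,
    Complex.mul_im, Complex.zero_re, Complex.zero_im] at hre him
  -- Isotropy means that the real and imaginary parts are orthogonal and of equal length, so after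
  -- scaling they start a rotated frame.
  have hxx : x ⬝ᵥ x = y ⬝ᵥ y := by
    simp only [dotProduct, Fin.sum_univ_three, hx, hy]
    linarith
  have hxy : x ⬝ᵥ y = 0 := by
    simp only [dotProduct, Fin.sum_univ_three, hx, hy]
    linarith
  have hpos : 0 < x ⬝ᵥ x := by
    refine lt_of_le_of_ne (Finset.sum_nonneg fun i _ => mul_self_nonneg _) fun h => hf0 ?_
    have hx0 := dotProduct_self_eq_zero.1 h.symm
    have hy0 := dotProduct_self_eq_zero.1 (hxx.symm.trans h.symm)
    funext i
    exact Complex.ext (congrFun hx0 i) (congrFun hy0 i)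
  obtain ⟨r, hr0, hr2⟩ : ∃ r : ℝ, r ≠ 0 ∧ r ^ 2 = x ⬝ᵥ x :=
    ⟨√_, (Real.sqrt_pos.2 hpos).ne', Real.sq_sqrt hpos.le⟩
  have h1 : (r⁻¹ • x) ⬝ᵥ (r⁻¹ • x) = 1 := by
    rw [smul_dotProduct, dotProduct_smul, ← hr2, smul_eq_mul, smul_eq_mul]
    field_simp
  have h2 : (r⁻¹ • y) ⬝ᵥ (r⁻¹ • y) = 1 := by
    rw [smul_dotProduct, dotProduct_smul, ← hxx, ← hr2, smul_eq_mul, smul_eq_mul]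
    field_simp
  have h3 : (r⁻¹ • x) ⬝ᵥ (r⁻¹ • y) = 0 := by
    rw [smul_dotProduct, dotProduct_smul, hxy]
    simp
  have hL := isFrame_rot_crossMat h1 h2 h3
  refine ⟨_, hL, r, hr0, ?_⟩
  have hb := exists_rform_of_isBivector ((isBivector_pullForm hL _).2 (isBivector_rform f))
  have hk : ![pullForm (rot (crossMat (r⁻¹ • x) (r⁻¹ • y))) (rform f (-Complex.I • f)) 1 0,
      pullForm (rot (crossMat (r⁻¹ • x) (r⁻¹ • y))) (rform f (-Complex.I • f)) 2 0,
      pullForm (rot (crossMat (r⁻¹ • x) (r⁻¹ • y))) (rform f (-Complex.I • f)) 3 0]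
      = (r : ℂ) • ![1, Complex.I, 0] := by
    have hxs : x 0 * x 0 + x 1 * x 1 + x 2 * x 2 = r ^ 2 := by
      rw [hr2, dotProduct, Fin.sum_univ_three]
    have hys : y 0 * y 0 + y 1 * y 1 + y 2 * y 2 = r ^ 2 := by
      rw [hr2, hxx, dotProduct, Fin.sum_univ_three]
    have hxys : x 0 * y 0 + x 1 * y 1 + x 2 * y 2 = 0 := by
      rw [← hxy, dotProduct, Fin.sum_univ_three]
    have hfe : ∀ i, f i = (x i : ℂ) + (y i : ℂ) * Complex.I := fun i => (Complex.re_add_im _).symm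
    funext i
    fin_cases i <;> apply Complex.ext <;>
      simp [pullForm, Matrix.mul_apply, Fin.sum_univ_succ, rot, crossMat, rform, hfe] <;>
      field_simp <;> linarith
  rw [hk] at hb
  exact hb

theorem exists_aligned_null_iff (hW : IsWeylTensor g W) (hP : IsFrame g P) :
    (∃ l, l ≠ 0 ∧ l ⬝ᵥ g *ᵥ l = 0 ∧ ∃ σ, 0 ≤ σ ∧ σ < Real.pi ∧ alignTensor g W σ l = 0) ↔
      ¬∃ ρ : Fin 3 → ℂ, Function.Injective ρ ∧ ∀ i, ∃ F, IsEigenbivector g W (ρ i) F := by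
  constructor
  · rintro ⟨l, hl0, hl, σ, -, -, h⟩
    obtain ⟨P', r, E, B, hP', hr, rfl, hE, hB, -, -, hEB⟩ := exists_adapted_null hW hP hl0 hl
    rw [alignTensor_eq_zero_iff hP', hEB, alignTensor_null_iff hE hB hr] at h
    rw [exists_distinct_eigenbivectors_iff hP' hEB,
      ← exists_isotropic_eigenvector_iff (isSymm_qMat hE hB)]
    refine ⟨![1, Complex.I, 0], fun h => ?_, ?_, (isDebeverEB_iff hE hB).1 h.1⟩
    · simpa using congrFun h 0
    · simp [dotProduct, Fin.sum_univ_succ]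
  · intro h
    obtain ⟨E, B, hE, hB, -, -, hEB⟩ := (hW.pull hP).exists_ofEB
    rw [exists_distinct_eigenbivectors_iff hP hEB,
      ← exists_isotropic_eigenvector_iff (isSymm_qMat hE hB)] at h
    obtain ⟨f, hf0, hff, μ, hf⟩ := h
    have hev : IsEigenbivector minkowski (pull P W) (-μ) (rform f (-Complex.I • f)) := by
      rw [hEB, isEigenbivector_ofEB_iff]
      exact ⟨f, hf0, by rw [hf, neg_neg], rfl⟩
    -- In the rotated frame the isotropic eigenvector is a multiple of (1, i, 0), so e₀ + e₃ there
    -- is the required null vector.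
    obtain ⟨L, hL, r, hr, hform⟩ := exists_rot_isotropic hf0 hff
    have hPL := hP.mul hL
    obtain ⟨E', B', hE', hB', -, -, hEB'⟩ := (hW.pull hPL).exists_ofEB
    rw [← isEigenbivector_pullForm hL, ← pull_mul, hEB', hform, isEigenbivector_ofEB_iff] at hev
    obtain ⟨k, -, hk, hk'⟩ := hev
    rw [← (rform_injective hk').1, mulVec_smul, smul_comm, neg_neg] at hk
    have hk2 := smul_right_injective _ (Complex.ofReal_ne_zero.2 hr) hk
    obtain ⟨σ, h1, h2, h3⟩ := exists_rotationIndex (E' 2 2) (B' 2 2)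
    have hn : ((1 : ℝ) • ![1, 0, 0, 1] : Fin 4 → ℝ) ≠ 0 := fun h => by simpa using congrFun h 0
    refine ⟨(P * L) *ᵥ ((1 : ℝ) • ![1, 0, 0, 1]), hPL.mulVec_ne_zero hn, ?_, σ, h1, h2, ?_⟩
    · rw [hPL.dotProduct, dotProduct_minkowski]
      simp
    · rw [alignTensor_eq_zero_iff hPL, hEB', alignTensor_null_iff hE' hB' one_ne_zero]
      exact ⟨(isDebeverEB_iff hE' hB').2 ⟨μ, hk2⟩, h3⟩

/-! ### Timelike vectors -/

theorem rot_congr_spatial (R A : Matrix (Fin 3) (Fin 3) ℝ) :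
    (rot R)ᵀ * spatial A * rot R = spatial (Rᵀ * A * R) := by
  ext i j
  fin_cases i <;> fin_cases j <;>
    simp [rot, spatial, Matrix.mul_apply, Fin.sum_univ_succ]

/-- A rotation fixes e₀, so the electric part transforms with the contraction by e₀; the magnetic
part is the electric part of the dual. -/
theorem ofEB_pull_rot {R E B E' B' : Matrix (Fin 3) (Fin 3) ℝ} (hR : IsFrame minkowski (rot R))
    (h : pull (rot R) (ofEB E B) = ofEB E' B') : E' = Rᵀ * E * R ∧ B' = Rᵀ * B * R := by
  have ht : rot R *ᵥ ![1, 0, 0, 0] = ![1, 0, 0, 0] := by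
    funext i
    fin_cases i <;> simp [rot, mulVec, dotProduct, Fin.sum_univ_succ]
  constructor
  · apply spatial_injective
    rw [← contractVec_ofEB_time E' B', ← h, contractVec_pull, ht, contractVec_ofEB_time,
      rot_congr_spatial]
  · apply spatial_injective
    have h' := dualTensor_pull hR (ofEB E B)
    rw [h, dualTensor_ofEB, dualTensor_ofEB] at h'
    rw [← contractVec_ofEB_time B' (-E'), h', contractVec_pull, ht, contractVec_ofEB_time,
      rot_congr_spatial]

/-- In a suitable frame adapted to a timelike Weyl-aligned vector, the electric and magnetic parts
are diagonal. -/
theorem exists_diagonal_frame (hW : IsWeylTensor g W) (hP : IsFrame g P) {u : Fin 4 → ℝ}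
    (hu : u ⬝ᵥ g *ᵥ u < 0) {σ : ℝ} (h : alignTensor g W σ u = 0) :
    ∃ (P' : Matrix (Fin 4) (Fin 4) ℝ) (r : ℝ) (e b : Fin 3 → ℝ), IsFrame g P' ∧
      r ≠ 0 ∧ u = P' *ᵥ (r • ![1, 0, 0, 0]) ∧
      pull P' W = ofEB (diagonal e) (diagonal b) ∧ alignE (diagonal e) (diagonal b) σ = 0 := by
  obtain ⟨x, rfl⟩ := hP.exists_mulVec_eq u
  rw [hP.dotProduct] at hu
  obtain ⟨L, hL, r, hr, rfl⟩ := exists_frame_of_timelike hu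
  have hPL := hP.mul hL
  obtain ⟨E, B, hE, hB, -, -, hEB⟩ := (hW.pull hPL).exists_ofEB
  rw [mulVec_mulVec, alignTensor_eq_zero_iff hPL, hEB, alignTensor_ofEB,
    contractVec_smul_eq_zero_iff _ hr, contractVec_ofEB_time] at h
  have h0 : alignE E B σ = 0 := spatial_injective (h.trans (by
    ext i j
    fin_cases i <;> fin_cases j <;> rfl))
  -- The vanishing of cos σ B + sin σ E means (E, B) = (cos σ H, -sin σ H) for this single real
  -- symmetric matrix, so one rotation diagonalises both.
  set H := Real.cos σ • E - Real.sin σ • B with hH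
  have hs := Real.sin_sq_add_cos_sq σ
  have hB' : Real.cos σ • B = -(Real.sin σ • E) := eq_neg_of_add_eq_zero_left h0
  have hE1 : E = Real.cos σ • H := by
    rw [hH, smul_sub, smul_comm (Real.cos σ) (Real.sin σ) B, hB', smul_neg, sub_neg_eq_add,
      smul_smul, smul_smul, ← add_smul, ← sq, ← sq, add_comm, hs, one_smul]
  have hB1 : B = -Real.sin σ • H := by
    have h1 : Real.sin σ • E = -(Real.cos σ • B) := by rw [hB', neg_neg]
    rw [hH, smul_sub, neg_smul, neg_smul, smul_comm (Real.sin σ) (Real.cos σ) E, h1, smul_neg,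
      neg_neg, sub_neg_eq_add, smul_smul, smul_smul, ← add_smul, ← sq, ← sq, add_comm, hs,
      one_smul]
  obtain ⟨R, hR, hRd, d, hd⟩ := exists_diagonalization (H := H) ((hE.smul _).sub (hB.smul _))
  have hrot := isFrame_rot hR hRd
  have hF := hPL.mul hrot
  obtain ⟨E', B', -, -, -, -, hEB'⟩ := (hW.pull hF).exists_ofEB
  have hEB2 := hEB'
  rw [pull_mul, hEB] at hEB2
  obtain ⟨hE2, hB2⟩ := ofEB_pull_rot hrot hEB2
  have hE3 : E' = diagonal (Real.cos σ • d) := by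
    rw [hE2, hE1, Matrix.mul_smul, Matrix.smul_mul, hd, diagonal_smul]
  have hB3 : B' = diagonal (-Real.sin σ • d) := by
    rw [hB2, hB1, Matrix.mul_smul, Matrix.smul_mul, hd, diagonal_smul]
  refine ⟨_, r, _, _, hF, hr, ?_, by rw [hEB', hE3, hB3], ?_⟩
  · have ht : rot R *ᵥ (r • ![1, 0, 0, 0]) = r • ![1, 0, 0, 0] := by
      funext i
      fin_cases i <;> simp [rot, mulVec, dotProduct, Fin.sum_univ_succ]
    rw [← mulVec_mulVec, ht, mulVec_mulVec]
  · rw [alignE, ← diagonal_smul, ← diagonal_smul, diagonal_add, ← diagonal_zero]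
    congr 1
    funext i
    simp
    ring

/-- In the diagonal frame the rotated tensor is purely magnetic and diagonal, hence annihilates e₁
as well. -/
theorem exists_spacelike_aligned_of_timelike (hW : IsWeylTensor g W) (hP : IsFrame g P)
    {u : Fin 4 → ℝ} (hu : u ⬝ᵥ g *ᵥ u < 0) {σ : ℝ} (h : alignTensor g W σ u = 0) :
    ∃ w, 0 < w ⬝ᵥ g *ᵥ w ∧ alignTensor g W σ w = 0 := by
  obtain ⟨P', r, e, b, hP', hr, -, hEB, h0⟩ := exists_diagonal_frame hW hP hu h
  refine ⟨P' *ᵥ ![0, 1, 0, 0], ?_, ?_⟩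
  · rw [hP'.dotProduct, dotProduct_minkowski]
    simp
  · have hb : alignB (diagonal e) (diagonal b) σ
        = diagonal (Real.cos σ • (-e) + Real.sin σ • b) := by
      rw [alignB, diagonal_neg, ← diagonal_smul, ← diagonal_smul, diagonal_add]
      rfl
    rw [alignTensor_eq_zero_iff hP', hEB, alignTensor_ofEB, h0, hb, contractVec_ofEB_diagonal]

/-- Lowering e₀ changes its sign, which makes the electric part of e₀ ∧ eᵢ the positive basis
vector. -/
theorem bivectorOf_minkowski (i : Fin 3) :
    bivectorOf minkowski (Pi.single 0 1) (Pi.single i.succ 1)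
      = rform (((1 / √2 : ℝ) : ℂ) • (Pi.single i 1 : Fin 3 → ℂ))
        (-Complex.I • ((1 / √2 : ℝ) : ℂ) • (Pi.single i 1 : Fin 3 → ℂ)) := by
  have hU : cplx (vecMulVec (lower minkowski (Pi.single 0 1))
      (lower minkowski (Pi.single i.succ 1)) - vecMulVec (lower minkowski (Pi.single i.succ 1))
      (lower minkowski (Pi.single 0 1))) = rform (Pi.single i 1 : Fin 3 → ℂ) 0 := by
    ext a b
    fin_cases i <;> fin_cases a <;> fin_cases b <;>
      simp [lower_eq, minkowski, vecMulVec_apply, rform]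
  rw [bivectorOf_eq, hU, dualForm_rform, smul_comm (-Complex.I), rform_smul]
  congr 1
  ext a b
  fin_cases a <;> fin_cases b <;> simp [rform]

theorem isEigenbivector_bivectorOf (hP : IsFrame g P) {e b : Fin 3 → ℝ}
    (hEB : pull P W = ofEB (diagonal e) (diagonal b)) (i : Fin 3) :
    IsEigenbivector g W (-((e i : ℂ) - Complex.I * b i))
      (bivectorOf g (P *ᵥ Pi.single 0 1) (P *ᵥ Pi.single i.succ 1)) := by
  rw [← isEigenbivector_pullForm hP, ← bivectorOf_frame hP, hEB, isEigenbivector_ofEB_iff,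
    bivectorOf_minkowski]
  refine ⟨_, ?_, ?_, rfl⟩
  · simp
  · rw [mulVec_smul, smul_comm, neg_neg]
    congr 1
    have : qMat (diagonal e) (diagonal b) = diagonal fun i => (e i : ℂ) - Complex.I * b i := by
      ext i j
      by_cases hij : i = j
      · subst hij
        simp [qMat]
      · simp [qMat, hij]
    rw [this]
    funext j
    by_cases hj : j = i
    · subst hj
      simp
    · simp [hj]

/-! ### Weyl-aligned directions of a spacetime -/

namespace Spacetime

variable {M : Type*} [TopologicalSpace M] [ChartedSpace R4 M] [IsManifold (𝓡 4) ∞ M]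
  (S : Spacetime M) (p : M)

theorem exists_isFrame_metricAt : ∃ P, IsFrame (S.metricAt p) P := by
  obtain ⟨P, hP⟩ := S.exists_frame_matrix (p := p)
  exact exists_isFrame hP

theorem isWeylTensor_weylAt : IsWeylTensor (S.metricAt p) (S.weylAt p) := by
  obtain ⟨P, hP⟩ := S.exists_frame_matrix (p := p)
  refine isWeylTensor_weylTensor (S.metricComp_contDiffAt (p := p)) (S.metricComp_symm _)
    fun h0 => ?_
  have := det_of_congr hP
  rw [metricAt, h0] at this
  norm_num at this

variable {p}

theorem exists_spacelike_aligned {σ : ℝ} {v : TangentSpace (𝓡 4) p}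
    (hv : S.IsTimelike v ∨ S.IsNull v) (h : S.IsWeylAlignedWith v σ) :
    ∃ w : TangentSpace (𝓡 4) p, S.IsSpacelike w ∧ S.IsWeylAlignedWith w σ := by
  obtain ⟨P, hP⟩ := S.exists_isFrame_metricAt p
  have hW := S.isWeylTensor_weylAt p
  obtain ⟨h1, h2, h3, h4⟩ := h
  obtain ⟨w, hw, hw'⟩ : ∃ w, 0 < w ⬝ᵥ S.metricAt p *ᵥ w ∧
      alignTensor (S.metricAt p) (S.weylAt p) σ w = 0 := by
    rcases hv with hv | ⟨hv0, hv⟩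
    · rw [IsTimelike, S.g_eq_metricAt] at hv
      exact exists_spacelike_aligned_of_timelike hW hP hv h4
    · rw [S.g_eq_metricAt] at hv
      exact exists_spacelike_aligned_of_null hW hP (comp_ne_zero.2 hv0) hv h4
  have hs : S.IsSpacelike ((compEquiv p).symm w) := by
    rw [IsSpacelike, S.g_eq_metricAt, comp_symm]
    exact hw
  refine ⟨(compEquiv p).symm w, hs, ?_, h2, h3, ?_⟩
  · rintro h0
    rw [IsSpacelike, h0, map_zero] at hs
    exact lt_irrefl _ hs
  · change alignTensor _ _ _ _ = 0
    rw [comp_symm, hw']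

theorem isWeylAligned_iff_isMultipleDebever {l : TangentSpace (𝓡 4) p} (hl : S.IsNull l) :
    S.IsWeylAligned l ↔ S.IsMultipleDebever l := by
  obtain ⟨P, hP⟩ := S.exists_isFrame_metricAt p
  have hg := hl.2
  rw [S.g_eq_metricAt] at hg
  have := exists_aligned_iff_debeverCondition (S.isWeylTensor_weylAt p) hP
    (comp_ne_zero.2 hl.1) hg
  constructor
  · rintro ⟨σ, -, h⟩
    exact ⟨hl, this.1 ⟨σ, h⟩⟩
  · rintro ⟨-, h⟩
    obtain ⟨σ, hσ⟩ := this.2 h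
    exact ⟨σ, hl.1, hσ⟩

theorem exists_null_aligned_iff : (∃ l : TangentSpace (𝓡 4) p, S.IsNull l ∧ S.IsWeylAligned l) ↔
    S.IsAlgebraicallySpecial p := by
  obtain ⟨P, hP⟩ := S.exists_isFrame_metricAt p
  rw [IsAlgebraicallySpecial, IsPetrovTypeI, ← exists_aligned_null_iff (S.isWeylTensor_weylAt p) hP]
  constructor
  · rintro ⟨l, ⟨hl0, hl⟩, σ, -, h⟩
    rw [S.g_eq_metricAt] at hl
    exact ⟨comp l, comp_ne_zero.2 hl0, hl, σ, h⟩
  · rintro ⟨l, hl0, hl, σ, h1, h2, h3⟩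
    have h0 : (compEquiv p).symm l ≠ 0 := by simpa using hl0
    refine ⟨(compEquiv p).symm l, ⟨h0, ?_⟩, σ, h0, h1, h2, ?_⟩
    · rw [S.g_eq_metricAt, comp_symm, hl]
    · change alignTensor _ _ _ _ = 0
      rw [comp_symm, h3]

/-- The diagonal frame has u along its time axis, and a diagonal Q has the standard basis as
eigenvectors, so the frame is canonical. -/
theorem isWeylPrincipal_of_timelike {u : TangentSpace (𝓡 4) p} (hu : S.IsTimelike u)
    (h : S.IsWeylAligned u) : S.IsWeylPrincipal u := by
  obtain ⟨P, hP⟩ := S.exists_isFrame_metricAt p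
  obtain ⟨σ, -, -, -, h⟩ := h
  rw [IsTimelike, S.g_eq_metricAt] at hu
  obtain ⟨P', r, e, b, hP', hr, hur, hEB, -⟩ :=
    exists_diagonal_frame (S.isWeylTensor_weylAt p) hP hu h
  refine ⟨fun i => (compEquiv p).symm (P' *ᵥ Pi.single i 1), ⟨fun i j => ?_, fun i => ?_⟩, 0, r,
    hr, ?_⟩
  · rw [S.g_eq_metricAt, comp_symm, comp_symm, hP'.dotProduct]
    simp
  · refine ⟨-((e i : ℂ) - Complex.I * b i), ?_⟩
    rw [comp_symm, comp_symm]
    exact isEigenbivector_bivectorOf hP' hEB i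
  · apply comp_injective
    rw [comp_smul, comp_symm, hur, mulVec_smul]
    congr 2
    funext i
    fin_cases i <;> simp

end Spacetime

end WeylAlign

end

theorem corollary1 {M : Type*} [TopologicalSpace M] [ChartedSpace WeylAlign.R4 M] [IsManifold (𝓡 4) ∞ M]
    (S : WeylAlign.Spacetime M) (p : M) :
    (∀ (σ : ℝ) (v : TangentSpace (𝓡 4) p), S.IsTimelike v ∨ S.IsNull v →
      S.IsWeylAlignedWith v σ →
        ∃ w : TangentSpace (𝓡 4) p, S.IsSpacelike w ∧ S.IsWeylAlignedWith w σ) ∧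
    (∀ l : TangentSpace (𝓡 4) p, S.IsNull l → (S.IsWeylAligned l ↔ S.IsMultipleDebever l)) ∧
    ((∃ l : TangentSpace (𝓡 4) p, S.IsNull l ∧ S.IsWeylAligned l) ↔
      S.IsAlgebraicallySpecial p) ∧
    (∀ u : TangentSpace (𝓡 4) p, S.IsTimelike u → S.IsWeylAligned u → S.IsWeylPrincipal u) := by
  exact ⟨fun _ _ hv h => S.exists_spacelike_aligned hv h,
    fun _ hl => S.isWeylAligned_iff_isMultipleDebever hl, S.exists_null_aligned_iff,
    fun _ hu h => S.isWeylPrincipal_of_timelike hu h⟩
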